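/- Let $\Lambda$ be a positive-definite even lattice of finite rank $d$ with bilinear form $\langle\cdot,\cdot\rangle$ (in particular, $\Lambda$ may be unimodular), let $\mathfrak h=\mathbb C\otimes_{\mathbb Z}\Lambda$ with the $\mathbb C$-bilinear extension of the form, and let $V_\Lambda=S\otimes\mathbb C\{\Lambda\}=\bigoplus_{\alpha\in\Lambda}S\otimes e^\alpha$, with $S=\mathrm{Sym}(\mathfrak h\otimes t^{-1}\mathbb C[t^{-1}])$, be the lattice vertex operator algebra of $\Lambda$, of central charge $d$, with vacuum $\mathbf 1$, vertex operators $Y(v,z)=\sum_{n\in\mathbb Z}v(n)z^{-n-1}$ and weight spaces $V_{(n)}$. For $v\in V_{(k)}$ let $o(v)=v(k-1)$, extend $o$ linearly to $V_\Lambda$, and define the character $$Z(v,q)=q^{-d/24}\sum_{n\in\mathbb Z}\mathrm{Tr}_{V_{(n)}}\big(o(v)\big)\,q^n .$$ For $a\in\mathfrak h$, identified with the state $a(-1)\mathbf 1$, define the square-bracket modes $a[n]$ by $Y(a,e^z-1)e^z=\sum_{n\in\mathbb Z}a[n]z^{-n-1}$, that is, $a[n]=\mathrm{Res}_w\,Y(a,w)\,(\log(1+w))^n$.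 Let $a\in\mathfrak h$ with $\langle a,a\rangle=1$, let $r\ge 3$ and $t\ge 1$ be odd integers, and put $v_{r,t}=(r-1)!\,a[-r]\,a[-1]^t\,\mathbf 1$. Then, as formal series in rational powers of $q$, $$Z(v_{r,t},q)=\frac{2t\,G_{r+1}(q)}{\eta(q)^{d}}\sum_{k=0}^{(t-1)/2}\binom{t-1}{2k}\frac{(2k)!}{k!}\,G_2(q)^k\,\Theta_{\Lambda,\,t-2k-1}(q),$$ where $\Theta_{\Lambda,s}(q)=\sum_{\alpha\in\Lambda}\langle a,\alpha\rangle^{s}\,q^{\langle\alpha,\alpha\rangle/2}$ (with $0^0=1$), $G_k(q)=-\frac{B_k}{2k}+\sum_{n\ge1}\sigma_{k-1}(n)q^n$, and $\eta(q)=q^{1/24}\prod_{n\ge1}(1-q^n)$. -/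

import Mathlib

noncomputable section

namespace LatticeVOA

open scoped TensorProduct

/-! ### The Fock space of a lattice

`Λ` is a lattice with `ℤ`-basis `b` and `ℤ`-valued bilinear form `B`. -/

/-- `S = Sym(𝔥 ⊗ t⁻¹ℂ[t⁻¹])` for `𝔥 = ℂ ⊗ Λ`, as the polynomial algebra on the basis
`b i ⊗ t^(-n-1)`; the variable `X (i, n)` is the creation operator `(b i)(-n-1)`. -/
abbrev Heis (d : ℕ) : Type := MvPolynomial (Fin d × ℕ) ℂ

/-- `V_Λ = S ⊗ ℂ{Λ} = ⨁_α S ⊗ e^α`; the element `u ⊗ e^α` is `Finsupp.single α u`. -/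
abbrev V (d : ℕ) (Λ : Type*) : Type _ := Λ →₀ Heis d

/-- `S ⊗ ℂ[z⁻¹]`; the polynomial variable of the coefficient ring is `z⁻¹`. -/
abbrev HeisZ (d : ℕ) : Type := MvPolynomial (Fin d × ℕ) (Polynomial ℂ)

section VertexOperators

variable {d : ℕ} {Λ : Type*} [AddCommGroup Λ]

/-- The weight `n + 1` of the creation operator `(b i)(-n-1)`. -/
def oscWeight (x : Fin d × ℕ) : ℤ := x.2 + 1

/-- The inclusion `S → S ⊗ ℂ[z⁻¹]`. -/
def constZ (d : ℕ) : Heis d →ₗ[ℂ] HeisZ d :=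
  (MvPolynomial.mapAlgHom (Algebra.ofId ℂ (Polynomial ℂ))).toLinearMap

/-- The inclusion `S ⊗ ℂ[z⁻¹] → S((z))`. -/
def toLaurent (d : ℕ) : HeisZ d →+* LaurentSeries (Heis d) :=
  MvPolynomial.eval₂Hom
    (Polynomial.eval₂RingHom (HahnSeries.C.comp MvPolynomial.C)
      (HahnSeries.single (-1 : ℤ) (1 : Heis d)))
    (fun x => HahnSeries.C (MvPolynomial.X x))

theorem toLaurent_smul (c : ℂ) (p : HeisZ d) : toLaurent d (c • p) = c • toLaurent d p := by
  have h1 : c • p = MvPolynomial.C (Polynomial.C c) * p := by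
    rw [MvPolynomial.C_mul', ← algebraMap_smul (Polynomial ℂ) c p]
    rfl
  rw [h1, map_mul]
  have h2 : toLaurent d (MvPolynomial.C (Polynomial.C c))
      = HahnSeries.C (MvPolynomial.C c : Heis d) := by
    simp [toLaurent]
  rw [h2]
  ext n : 2
  rw [HahnSeries.C_apply, HahnSeries.single_zero_mul_eq_smul, HahnSeries.coeff_smul,
    HahnSeries.coeff_smul, smul_eq_mul, MvPolynomial.C_mul']

theorem mul_smul_laurent (c : ℂ) (x y : LaurentSeries (Heis d)) :
    x * (c • y) = c • (x * y) := by
  have h : ∀ z : LaurentSeries (Heis d),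
      c • z = HahnSeries.C (MvPolynomial.C c : Heis d) * z := by
    intro z
    ext n : 2
    rw [HahnSeries.C_apply, HahnSeries.single_zero_mul_eq_smul, HahnSeries.coeff_smul,
      HahnSeries.coeff_smul, smul_eq_mul, MvPolynomial.C_mul']
  rw [h, h, mul_left_comm]

/-- The creation part of `(1/n!) ∂_zⁿ (b i)(z)`, i.e. the power series
`∑_{k ≥ 0} C(n+k, n) (b i)(-n-k-1) z^k`, as an element of `S((z))`. -/
def creation (x : Fin d × ℕ) : LaurentSeries (Heis d) :=
  HahnSeries.ofPowerSeries ℤ (Heis d)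
    (PowerSeries.mk fun k =>
      ((x.2 + k).choose x.2 : ℂ) • (MvPolynomial.X (x.1, x.2 + k) : Heis d))

/-- The annihilation part of `(1/n!) ∂_zⁿ (b i)(z)` acting on `S ⊗ e^α`, i.e.
`∑_{m ≥ 0} (-1)ⁿ C(m+n, n) (b i)(m) z^(-m-n-1)`. Here `(b i)(0)` is the scalar `⟨b i, α⟩`
and `(b i)(m)`, for `m ≥ 1`, is the derivation of `S` which sends `(b j)(-k-1)`
to `m ⟨b i, b j⟩` if `m = k + 1` and to `0` otherwise. -/
def annihilation (B : LinearMap.BilinForm ℤ Λ) (b : Module.Basis (Fin d) ℤ Λ) (α : Λ)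
    (x : Fin d × ℕ) : HeisZ d →ₗ[Polynomial ℂ] HeisZ d :=
  (MvPolynomial.mkDerivation (Polynomial ℂ) (fun y : Fin d × ℕ =>
      (MvPolynomial.C (Polynomial.monomial (y.2 + x.2 + 2)
        ((-1) ^ x.2 * ((y.2 + 1 + x.2).choose x.2 : ℂ) * (y.2 + 1)
          * (B (b x.1) (b y.1) : ℂ))) : HeisZ d))).toLinearMap
    + (Polynomial.monomial (x.2 + 1) ((-1) ^ x.2 * (B (b x.1) α : ℂ))) •
        (LinearMap.id : HeisZ d →ₗ[Polynomial ℂ] HeisZ d)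

theorem annihilation_comm (B : LinearMap.BilinForm ℤ Λ) (b : Module.Basis (Fin d) ℤ Λ) (α : Λ)
    (x y : Fin d × ℕ) :
    annihilation B b α x ∘ₗ annihilation B b α y
      = annihilation B b α y ∘ₗ annihilation B b α x := by
  have key : ∀ f g : Fin d × ℕ → Polynomial ℂ, ∀ p : HeisZ d,
      MvPolynomial.mkDerivation (Polynomial ℂ) (fun i => (MvPolynomial.C (f i) : HeisZ d))
        (MvPolynomial.mkDerivation (Polynomial ℂ) (fun i => (MvPolynomial.C (g i) : HeisZ d)) p)
      = MvPolynomial.mkDerivation (Polynomial ℂ) (fun i => (MvPolynomial.C (g i) : HeisZ d))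
        (MvPolynomial.mkDerivation (Polynomial ℂ)
          (fun i => (MvPolynomial.C (f i) : HeisZ d)) p) := by
    intro f g p
    have h : ⁅MvPolynomial.mkDerivation (Polynomial ℂ)
          (fun i => (MvPolynomial.C (f i) : HeisZ d)),
        MvPolynomial.mkDerivation (Polynomial ℂ)
          (fun i => (MvPolynomial.C (g i) : HeisZ d))⁆ = 0 := by
      apply MvPolynomial.derivation_ext
      intro i
      simp [Derivation.commutator_apply, MvPolynomial.mkDerivation_X]
    have h2 := congrArg (fun D => D p) h
    simp only [Derivation.commutator_apply, Derivation.coe_zero, Pi.zero_apply] at h2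
    exact sub_eq_zero.mp h2
  refine LinearMap.ext fun p => ?_
  simp only [annihilation, LinearMap.comp_apply, LinearMap.add_apply, LinearMap.smul_apply,
    LinearMap.id_apply, Derivation.coeFn_coe, map_add, map_smul, smul_add]
  rw [key, smul_comm]
  abel

/-- The bimultiplicative cocycle `ε` on `Λ` with `ε(b i, b j) = (-1)^⟨b i, b j⟩` for `i > j` and
`ε(b i, b j) = 1` for `i ≤ j`; for an even form, `ε(α, β) ε(β, α)⁻¹ = (-1)^⟨α, β⟩`. -/
def cocycle (B : LinearMap.BilinForm ℤ Λ) (b : Module.Basis (Fin d) ℤ Λ) (α β : Λ) : ℂ :=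
  ∏ i : Fin d, ∏ j ∈ Finset.univ.filter (fun j : Fin d => j < i),
    (-1 : ℂ) ^ (b.repr α i * b.repr β j * B (b i) (b j))

/-- `E⁻(-β, z) = exp (∑_{n ≥ 1} β(-n) z^n / n)` as a power series over `S`. -/
def expCreation (b : Module.Basis (Fin d) ℤ Λ) (β : Λ) : PowerSeries (Heis d) :=
  let g : PowerSeries (Heis d) := PowerSeries.mk fun n =>
    if n = 0 then 0 else
      ∑ i : Fin d, ((b.repr β i : ℂ) / n) • (MvPolynomial.X (i, n - 1) : Heis d)
  PowerSeries.mk fun n =>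
    ∑ k ∈ Finset.range (n + 1), ((k.factorial : ℂ)⁻¹) • PowerSeries.coeff n (g ^ k)

/-- `E⁺(-β, z) = exp (-∑_{n ≥ 1} β(n) z^(-n) / n)` acting on `S`: the exponential of a derivation,
i.e. the algebra map `(b j)(-n-1) ↦ (b j)(-n-1) - ⟨β, b j⟩ z^(-n-1)`. -/
def expAnnihilation (B : LinearMap.BilinForm ℤ Λ) (b : Module.Basis (Fin d) ℤ Λ) (β : Λ) :
    HeisZ d →ₐ[Polynomial ℂ] HeisZ d :=
  MvPolynomial.aeval fun y =>
    (MvPolynomial.X y - MvPolynomial.C (Polynomial.monomial (y.2 + 1) (B β (b y.1) : ℂ)) :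
      HeisZ d)

/-- The operator `Y(1 ⊗ e^β, z) = E⁻(-β, z) E⁺(-β, z) e_β z^β` from `S ⊗ e^α` to
`S((z)) ⊗ e^(α+β)`, where `e_β z^β` acts on `S ⊗ e^α` by the factor `ε(β, α) z^⟨β, α⟩`. -/
def expField (B : LinearMap.BilinForm ℤ Λ) (b : Module.Basis (Fin d) ℤ Λ) (β α : Λ) :
    HeisZ d →ₗ[ℂ] LaurentSeries (Heis d) where
  toFun p :=
    HahnSeries.single (B β α) (MvPolynomial.C (cocycle B b β α) : Heis d)
      * HahnSeries.ofPowerSeries ℤ (Heis d) (expCreation b β)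
      * toLaurent d (expAnnihilation B b β p)
  map_add' p q := by rw [map_add, map_add, mul_add]
  map_smul' c p := by
    rw [AlgHom.map_smul_of_tower, toLaurent_smul, mul_smul_laurent, RingHom.id_apply]

/-- Normally ordered product of the field `(1/n!) ∂_zⁿ (b i)(z)` with a field `F`
(both acting on `S ⊗ e^α`): creation operators to the left of `F`, annihilation operators
to its right. -/
def normalOrder (B : LinearMap.BilinForm ℤ Λ) (b : Module.Basis (Fin d) ℤ Λ) (α : Λ)
    (x : Fin d × ℕ) (F : HeisZ d →ₗ[ℂ] LaurentSeries (Heis d)) :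
    HeisZ d →ₗ[ℂ] LaurentSeries (Heis d) where
  toFun p := creation x * F p + F (annihilation B b α x p)
  map_add' p q := by simp only [map_add, mul_add]; abel
  map_smul' c p := by
    rw [LinearMap.map_smul_of_tower (annihilation B b α x), F.map_smul, F.map_smul,
      mul_smul_laurent, RingHom.id_apply, smul_add]

instance normalOrder_leftCommutative (B : LinearMap.BilinForm ℤ Λ)
    (b : Module.Basis (Fin d) ℤ Λ) (α : Λ) : LeftCommutative (normalOrder B b α) where
  left_comm x y F := by
    refine LinearMap.ext fun p => ?_
    have h := congrArg (fun T => T p) (annihilation_comm B b α x y)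
    simp only [LinearMap.comp_apply] at h
    change creation x * (creation y * F p + F (annihilation B b α y p))
        + (creation y * F (annihilation B b α x p)
          + F (annihilation B b α y (annihilation B b α x p)))
      = creation y * (creation x * F p + F (annihilation B b α x p))
        + (creation x * F (annihilation B b α y p)
          + F (annihilation B b α x (annihilation B b α y p)))
    rw [h]
    ring

/-- The field of `(∏ₖ (b iₖ)(-nₖ-1)) ⊗ e^β`, where `s` is the exponent vector of the monomial,
from `S ⊗ e^α` to `S((z)) ⊗ e^(α+β)`: the normally ordered product
`: ∏ₖ (1/nₖ!) ∂_z^{nₖ} (b iₖ)(z) Y(1 ⊗ e^β, z) :`. -/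
def monomialField (B : LinearMap.BilinForm ℤ Λ) (b : Module.Basis (Fin d) ℤ Λ) (β α : Λ)
    (s : Fin d × ℕ →₀ ℕ) : Heis d →ₗ[ℂ] LaurentSeries (Heis d) :=
  (Multiset.foldr (normalOrder B b α) (expField B b β α) (Finsupp.toMultiset s)) ∘ₗ constZ d

theorem hahnModule_of_smul {W : Type*} [AddCommGroup W] [Module ℂ W] (c : ℂ)
    (x : HahnSeries ℤ W) : HahnModule.of ℂ (c • x) = c • HahnModule.of ℂ x := rfl

/-- The inclusion `S((z)) ⊗ e^γ → V_Λ((z))`. -/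
def inclSector (d : ℕ) (γ : Λ) : LaurentSeries (Heis d) →ₗ[ℂ] HahnModule ℤ ℂ (V d Λ) where
  toFun x := HahnModule.of ℂ (x.map (Finsupp.lsingle (R := ℂ) (M := Heis d) γ))
  map_add' x y := by
    apply (HahnModule.of ℂ).symm.injective
    ext n : 2
    simp
  map_smul' c x := by
    rw [RingHom.id_apply, ← hahnModule_of_smul]
    apply (HahnModule.of ℂ).symm.injective
    ext n : 2
    simp

/-- The state-field correspondence `v ↦ Y(v, z)` of the lattice vertex algebra `V_Λ`. -/
def Y (B : LinearMap.BilinForm ℤ Λ) (b : Module.Basis (Fin d) ℤ Λ) :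
    V d Λ →ₗ[ℂ] VertexOperator ℂ (V d Λ) :=
  Finsupp.lsum ℂ fun β =>
    (MvPolynomial.basisMonomials (Fin d × ℕ) ℂ).constr ℂ fun s =>
      Finsupp.lsum ℂ fun α => inclSector d (α + β) ∘ₗ monomialField B b β α s

/-- The mode `v(n)`: `Y(v, z) = ∑ v(n) z^(-n-1)`. -/
def mode (B : LinearMap.BilinForm ℤ Λ) (b : Module.Basis (Fin d) ℤ Λ) (v : V d Λ) (n : ℤ) :
    Module.End ℂ (V d Λ) :=
  VertexOperator.ncoeff (Y B b v) n

/-- The vacuum `𝟏 = 1 ⊗ e^0`. -/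
def vacuum (d : ℕ) (Λ : Type*) [AddCommGroup Λ] : V d Λ := Finsupp.single 0 1

/-- The state `a(-1)𝟏 ∈ V_Λ` of `a ∈ 𝔥 = ℂ ⊗ Λ`. -/
def cartanState (b : Module.Basis (Fin d) ℤ Λ) (a : ℂ ⊗[ℤ] Λ) : V d Λ :=
  Finsupp.single 0 (∑ i : Fin d, (b.baseChange ℂ).repr a i • (MvPolynomial.X (i, 0) : Heis d))

/-- The series `log (1 + w)`. -/
def logOneAdd : LaurentSeries ℂ :=
  HahnSeries.ofPowerSeries ℤ ℂ (PowerSeries.mk fun n => (-1 : ℂ) ^ (n + 1) / n)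

/-- The square-bracket mode `a[n] = Res_z z^n e^z Y(a(-1)𝟏, e^z - 1)
= Res_w (log (1 + w))^n Y(a(-1)𝟏, w)` of `a ∈ 𝔥`, applied to `u ∈ V_Λ`. -/
def squareMode (B : LinearMap.BilinForm ℤ Λ) (b : Module.Basis (Fin d) ℤ Λ) (a : ℂ ⊗[ℤ] Λ)
    (n : ℤ) (u : V d Λ) : V d Λ :=
  ((HahnModule.of ℂ).symm ((logOneAdd ^ n) • (Y B b (cartanState b a) u))).coeff (-1)

/-! ### Grading, zero modes, characters -/

/-- The projection of `V_Λ` onto its weight `n` part, where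
`a₁(-n₁)⋯aₖ(-nₖ)𝟏 ⊗ e^α` has weight `n₁ + ⋯ + nₖ + ⟨α, α⟩ / 2`. -/
def weightProj (d : ℕ) (B : LinearMap.BilinForm ℤ Λ) (n : ℤ) : V d Λ →ₗ[ℂ] V d Λ :=
  Finsupp.lsum ℂ fun α =>
    Finsupp.lsingle α ∘ₗ
      MvPolynomial.weightedHomogeneousComponent (R := ℂ) oscWeight (n - B α α / 2)

/-- The weight space `V_(n)`: the span of the `a₁(-n₁)⋯aₖ(-nₖ)𝟏 ⊗ e^α` with
`n₁ + ⋯ + nₖ + ⟨α, α⟩ / 2 = n`. -/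
def weightSpace (d : ℕ) (B : LinearMap.BilinForm ℤ Λ) (n : ℤ) : Submodule ℂ (V d Λ) where
  carrier := {v | ∀ α, v α ∈ MvPolynomial.weightedHomogeneousSubmodule ℂ oscWeight
    (n - B α α / 2)}
  zero_mem' _ := Submodule.zero_mem _
  add_mem' hv hw α := Submodule.add_mem _ (hv α) (hw α)
  smul_mem' c _ hv α := Submodule.smul_mem _ c (hv α)

theorem weightProj_apply (B : LinearMap.BilinForm ℤ Λ) (n : ℤ) (v : V d Λ) (α : Λ) :
    weightProj d B n v α
      = MvPolynomial.weightedHomogeneousComponent oscWeight (n - B α α / 2) (v α) := by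
  classical
  induction v using Finsupp.induction_linear with
  | zero => simp
  | add f g hf hg => simp [hf, hg]
  | single β u =>
    by_cases h : β = α
    · subst h; simp [weightProj]
    · simp [weightProj, h]

theorem weightProj_mem (B : LinearMap.BilinForm ℤ Λ) (n : ℤ) (v : V d Λ) :
    weightProj d B n v ∈ weightSpace d B n := fun α => by
  rw [weightProj_apply]
  exact MvPolynomial.weightedHomogeneousComponent_mem _ _ _

/-- For a positive definite form there are no negative weights. -/
theorem weightSpace_eq_bot (B : LinearMap.BilinForm ℤ Λ) (hB : ∀ α, α ≠ 0 → 0 < B α α)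
    (n : ℤ) (hn : n < 0) : weightSpace d B n = ⊥ := by
  rw [eq_bot_iff]
  intro v hv
  rw [Submodule.mem_bot]
  ext α s
  by_contra hne
  have h := hv α hne
  have h1 : 0 ≤ Finsupp.weight (oscWeight (d := d)) s := by
    rw [Finsupp.weight_apply]
    exact Finset.sum_nonneg fun x _ => nsmul_nonneg (by unfold oscWeight; positivity) _
  have h2 : 0 ≤ B α α := by
    by_cases h0 : α = 0
    · simp [h0]
    · exact (hB α h0).le
  omega

/-- The zero mode `o(v)`: `o(v) = v(k-1)` for `v` of weight `k`, extended additively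
(only finitely many terms of the sum are non-zero). -/
def zeroMode (B : LinearMap.BilinForm ℤ Λ) (b : Module.Basis (Fin d) ℤ Λ) (v : V d Λ) :
    Module.End ℂ (V d Λ) :=
  ∑ᶠ k : ℤ, mode B b (weightProj d B k v) (k - 1)

/-- The trace of `o(v)` on `V_(n)`. As `o(v)` preserves `V_(n)`, composing with the projection
to `V_(n)` just restricts the codomain. -/
def zeroModeTrace (B : LinearMap.BilinForm ℤ Λ) (b : Module.Basis (Fin d) ℤ Λ) (v : V d Λ)
    (n : ℤ) : ℂ :=
  LinearMap.trace ℂ (weightSpace d B n)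
    (((weightProj d B n).codRestrict (weightSpace d B n) (weightProj_mem B n))
      ∘ₗ zeroMode B b v ∘ₗ (weightSpace d B n).subtype)

/-- The character `Z(v, q) = q^(-d/24) ∑_n Tr_{V_(n)} o(v) q^n`, a formal series in rational powers
of `q` (the central charge of `V_Λ` is the rank `d`, and there are no negative weights). -/
def character (B : LinearMap.BilinForm ℤ Λ) (b : Module.Basis (Fin d) ℤ Λ) (v : V d Λ) :
    HahnSeries ℚ ℂ :=
  HahnSeries.single (-(d : ℚ) / 24) (1 : ℂ) *
    HahnSeries.ofPowerSeries ℚ ℂ (PowerSeries.mk fun n : ℕ => zeroModeTrace B b v n)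

end VertexOperators

/-! ### `q`-series -/

/-- `G_k(q) = -B_k/(2k) + ∑_{n ≥ 1} σ_{k-1}(n) q^n`. -/
def eisensteinG (k : ℕ) : PowerSeries ℂ :=
  PowerSeries.mk fun n =>
    if n = 0 then -((bernoulli k : ℚ) : ℂ) / (2 * k)
    else (ArithmeticFunction.sigma (k - 1) n : ℂ)

/-- `η(q) = q^(1/24) ∏_{n ≥ 1} (1 - q^n)`; the factors with `n > N` do not affect the coefficient
of `q^N` in the product. -/
def eta : HahnSeries ℚ ℂ :=
  HahnSeries.single (1 / 24 : ℚ) (1 : ℂ) *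
    HahnSeries.ofPowerSeries ℚ ℂ (PowerSeries.mk fun N =>
      PowerSeries.coeff N (∏ n ∈ Finset.Icc 1 N, (1 - PowerSeries.X ^ n : PowerSeries ℂ)))

/-- `Θ_{Λ,s}(q) = ∑_{α ∈ Λ} ⟨a, α⟩^s q^(⟨α, α⟩ / 2)`, where `0^0 = 1`; for an even positive
definite form, each power of `q` receives contributions from finitely many `α`. -/
def theta {Λ : Type*} [AddCommGroup Λ] (B : LinearMap.BilinForm ℤ Λ) (a : ℂ ⊗[ℤ] Λ) (s : ℕ) :
    PowerSeries ℂ :=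
  PowerSeries.mk fun n =>
    ∑ᶠ α ∈ {α : Λ | B α α = 2 * (n : ℤ)},
      (LinearMap.BilinForm.baseChange ℂ B a ((1 : ℂ) ⊗ₜ[ℤ] α)) ^ s

end LatticeVOA

end

/-!
The state `a[-r] a[-1]^t 𝟏` lies in the vacuum sector `S`, so its field is a normally ordered
polynomial in the derivatives of the free fields `(b i)(z)`; it preserves each sector `S ⊗ e^α`, on
which it only depends on `α` through the zero modes `⟨b i, α⟩`. The trace on `V_Λ` is therefore a
sum over `α` of traces on `S` (`zeroModeTrace_single`).

In such a trace the formal variable plays no role. The component of a normally ordered product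
which preserves the weight is the coefficient that contributes to a diagonal matrix entry, so `z`
may be set to `1` (`coeff_foldr_normalOrder`); since a coefficient of `q^n` involves only the
oscillators of level at most `n`, the creation operators may be truncated, and the field becomes an
endomorphism `wickField f` of a polynomial ring.

Moving an oscillator of level `m` once around the trace multiplies it by `q^m`, at the cost of its
commutator with the rest of the product. This gives Wick's recursion `gradedTrace_wickField_X_mul`:
removing one field `a(-n-1)` from `f` costs the zero mode `⟨a, α⟩` times the trace of the rest, plus
`∑ₘ q^m / (1 - q^m)` times traces of constant-coefficient derivatives of the rest.

On the other side, `a[-r]` acts on `S` as a linear form in the `a(-n-1)` plus a constant-coefficient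
derivation (`squareMode_neg_single`), with coefficients those of `log(1 + w)^(-r)`. The substitution
`1 + w = e^z`, in the form `coeff_invLogQuot_pow_mul`, turns the binomial coefficients of the modes
of `a(-n-1)` into the powers `m^(r-1) / (r-1)!`, so that the sum over `m` is the Lambert series of
`G_{r+1}`; the derivation supplies the constant term `-B_{r+1} / (2(r+1))`
(`coeff_succ_invLogQuot_pow`). As constant-coefficient derivations commute with `a[-1]` up to
scalars, the outcome is (`sectorTrace_squareOp`), with `T` the trace on a sector,

  `(r-1)! T(a[-r] a[-1]^t 𝟏) = 2 t G_{r+1} T(a[-1]^(t-1) 𝟏)` for odd `r ≥ 3`,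
  `T(a[-1]^(s+1) 𝟏) = ⟨a, α⟩ T(a[-1]^s 𝟏) + 2 s G_2 T(a[-1]^(s-1) 𝟏)`.

The second line is the recursion of the moments of a Gaussian of mean `⟨a, α⟩` and variance `2 G_2`
(`gaussian_recursion`), and `T(𝟏) = ∏ (1 - q^n)^(-d)`. Summing over `α` gives theta series.
-/

noncomputable section

namespace LatticeVOA

/-! ### Graded traces on polynomial algebras -/

section GradedTrace

open MvPolynomial Finset

variable {σ : Type*}

/-- The exponent vectors supported in `Y` of weight `N`. -/
def weightExponents (Y : Finset σ) (w : σ → ℕ) (N : ℕ) : Finset (σ →₀ ℕ) :=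
  (Y.finsupp fun _ => range (N + 1)).filter fun s => Finsupp.weight w s = N

theorem mem_weightExponents {Y : Finset σ} {w : σ → ℕ} (hw : ∀ y, 0 < w y) {N : ℕ}
    {s : σ →₀ ℕ} :
    s ∈ weightExponents Y w N ↔ s.support ⊆ Y ∧ Finsupp.weight w s = N := by
  rw [weightExponents, mem_filter, mem_finsupp_iff]
  refine ⟨fun h => ⟨h.1.1, h.2⟩, fun h => ⟨⟨h.1, fun i _ => ?_⟩, h.2⟩⟩
  have := Finsupp.le_weight w (hw i).ne' s
  rw [mem_range]
  omega

/-- The graded trace `∑_N Tr(φ | weight N) q^N` of an endomorphism of `ℂ[σ]`, taken over the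
monomials in the variables of `Y` only. -/
def gradedTrace (Y : Finset σ) (w : σ → ℕ) :
    Module.End ℂ (MvPolynomial σ ℂ) →ₗ[ℂ] PowerSeries ℂ where
  toFun φ := PowerSeries.mk fun N => ∑ s ∈ weightExponents Y w N, coeff s (φ (monomial s 1))
  map_add' φ ψ := by
    ext N
    simp [sum_add_distrib]
  map_smul' c φ := by
    ext N
    simp [mul_sum]

theorem coeff_gradedTrace (Y : Finset σ) (w : σ → ℕ) (φ : Module.End ℂ (MvPolynomial σ ℂ))
    (N : ℕ) : PowerSeries.coeff N (gradedTrace Y w φ)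
      = ∑ s ∈ weightExponents Y w N, coeff s (φ (monomial s 1)) := by
  simp [gradedTrace]

theorem gradedTrace_congr {Y : Finset σ} {w : σ → ℕ} (hw : ∀ y, 0 < w y)
    {φ ψ : Module.End ℂ (MvPolynomial σ ℂ)}
    (h : ∀ s : σ →₀ ℕ, s.support ⊆ Y → φ (monomial s 1) = ψ (monomial s 1)) :
    gradedTrace Y w φ = gradedTrace Y w ψ := by
  ext N
  rw [coeff_gradedTrace, coeff_gradedTrace]
  refine sum_congr rfl fun s hs => ?_
  rw [h s ((mem_weightExponents hw).1 hs).1]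

/-- Removing one factor `X y` from each monomial divisible by it. -/
theorem sum_weightExponents_shift {Y : Finset σ} {w : σ → ℕ} (hw : ∀ y, 0 < w y) {y : σ}
    (hy : y ∈ Y) (N : ℕ) {R : Type*} [AddCommMonoid R] (h : (σ →₀ ℕ) → R) :
    ∑ s ∈ weightExponents Y w N, (if s y = 0 then 0 else h s)
      = if w y ≤ N then
          ∑ s ∈ weightExponents Y w (N - w y), h (s + Finsupp.single y 1) else 0 := by
  classical
  have hwt : ∀ s : σ →₀ ℕ, Finsupp.weight w (s + Finsupp.single y 1)
      = Finsupp.weight w s + w y := by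
    intro s
    rw [map_add, Finsupp.weight_apply w (Finsupp.single y 1)]
    simp
  have hsub : ∀ s : σ →₀ ℕ, s y ≠ 0 → s - Finsupp.single y 1 + Finsupp.single y 1 = s :=
    fun s h0 => tsub_add_cancel_of_le (Finsupp.single_le_iff.2 (Nat.one_le_iff_ne_zero.2 h0))
  split_ifs with hN
  · rw [← sum_filter_ne_zero]
    symm
    refine sum_bij_ne_zero (fun s _ _ => s + Finsupp.single y 1) ?_ ?_ ?_ ?_
    · intro s hs hne
      obtain ⟨h1, h2⟩ := (mem_weightExponents hw).1 hs
      rw [mem_filter, mem_weightExponents hw]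
      refine ⟨⟨Finsupp.support_add.trans (union_subset h1 ?_), ?_⟩, by simpa using hne⟩
      · exact Finsupp.support_single_subset.trans (by simpa using hy)
      · rw [hwt, h2]
        omega
    · intro s _ _ s' _ _ h
      exact add_left_injective _ h
    · intro s hs hne
      have h0 : s y ≠ 0 := fun h0 => hne (if_pos h0)
      obtain ⟨h1, h2⟩ := (mem_weightExponents hw).1 (mem_filter.1 hs).1
      refine ⟨s - Finsupp.single y 1, (mem_weightExponents hw).2
        ⟨Finsupp.support_tsub.trans h1, ?_⟩, ?_, hsub s h0⟩
      · have := hwt (s - Finsupp.single y 1)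
        rw [hsub s h0, h2] at this
        omega
      · rw [hsub s h0]
        rwa [if_neg h0] at hne
    · intro s _ _
      simp
  · refine sum_eq_zero fun s hs => ?_
    rw [if_pos]
    by_contra h0
    have h2 := ((mem_weightExponents hw).1 hs).2
    have := hwt (s - Finsupp.single y 1)
    rw [hsub s h0] at this
    omega

/-- Cyclicity of the graded trace for a creation operator, which raises the weight by `w y`. -/
theorem gradedTrace_mulLeft_comp {Y : Finset σ} {w : σ → ℕ} (hw : ∀ y, 0 < w y) {y : σ}
    (hy : y ∈ Y) (φ : Module.End ℂ (MvPolynomial σ ℂ)) :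
    gradedTrace Y w (LinearMap.mulLeft ℂ (X y) ∘ₗ φ)
      = PowerSeries.X ^ w y * gradedTrace Y w (φ ∘ₗ LinearMap.mulLeft ℂ (X y)) := by
  classical
  ext N
  rw [PowerSeries.coeff_X_pow_mul', coeff_gradedTrace, coeff_gradedTrace]
  refine Eq.trans ?_ ((sum_weightExponents_shift hw hy N
    fun s => coeff (s - Finsupp.single y 1) (φ (monomial s 1))).trans ?_)
  · refine sum_congr rfl fun s _ => ?_
    simp only [LinearMap.comp_apply, LinearMap.mulLeft_apply, coeff_X_mul', Finsupp.mem_support_iff]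
    split_ifs <;> simp_all
  · refine if_congr Iff.rfl (sum_congr rfl fun s _ => ?_) rfl
    simp only [LinearMap.comp_apply, LinearMap.mulLeft_apply, add_tsub_cancel_right, X,
      monomial_mul, one_mul, add_comm]

/-- Cyclicity of the graded trace for an annihilation operator, which lowers the weight by
`w y`. -/
theorem gradedTrace_comp_pderiv {Y : Finset σ} {w : σ → ℕ} (hw : ∀ y, 0 < w y) {y : σ}
    (hy : y ∈ Y) (φ : Module.End ℂ (MvPolynomial σ ℂ)) :
    gradedTrace Y w (φ ∘ₗ (pderiv y).toLinearMap)
      = PowerSeries.X ^ w y * gradedTrace Y w ((pderiv y).toLinearMap ∘ₗ φ) := by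
  ext N
  rw [PowerSeries.coeff_X_pow_mul', coeff_gradedTrace, coeff_gradedTrace]
  refine Eq.trans ?_ ((sum_weightExponents_shift hw hy N
    fun s => coeff s (φ (monomial (s - Finsupp.single y 1) (s y : ℂ)))).trans ?_)
  · refine sum_congr rfl fun s _ => ?_
    simp only [LinearMap.comp_apply, Derivation.coeFn_coe, pderiv_monomial, one_mul]
    split_ifs with h <;> simp [h]
  · refine if_congr Iff.rfl (sum_congr rfl fun s _ => ?_) rfl
    simp only [LinearMap.comp_apply, Derivation.coeFn_coe, coeff_pderiv, add_tsub_cancel_right]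
    have h1 : monomial s ((((s + Finsupp.single y 1 : σ →₀ ℕ) y : ℕ)) : ℂ)
        = ((s y : ℂ) + 1) • monomial s (1 : ℂ) := by
      simp [smul_monomial]
    rw [h1, map_smul, coeff_smul, smul_eq_mul, mul_comm]

/-- The series `q^m / (1 - q^m) = ∑_{j ≥ 1} q^(mj)`. -/
def lambertTerm (m : ℕ) : PowerSeries ℂ :=
  PowerSeries.mk fun j => if j ≠ 0 ∧ m ∣ j then 1 else 0

theorem one_sub_X_pow_mul_lambertTerm {m : ℕ} (hm : 0 < m) :
    (1 - PowerSeries.X ^ m) * lambertTerm m = PowerSeries.X ^ m := by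
  ext j
  rw [sub_mul, one_mul, map_sub, PowerSeries.coeff_X_pow_mul', PowerSeries.coeff_X_pow]
  simp only [lambertTerm, PowerSeries.coeff_mk]
  rcases lt_trichotomy j m with h | h | h
  · have h1 : ¬ (j ≠ 0 ∧ m ∣ j) := fun ⟨h0, h1⟩ => absurd (Nat.le_of_dvd (by omega) h1) (by omega)
    rw [if_neg h1, if_neg (by omega), if_neg (by omega), sub_zero]
  · subst h
    simp [hm.ne']
  · rw [if_pos h.le, if_neg h.ne']
    have h0 : (m ∣ j - m) ↔ m ∣ j := by
      rw [Nat.dvd_sub_self_right]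
      exact or_iff_left h.not_ge
    have h1 : j - m ≠ 0 := by omega
    have h2 : j ≠ 0 := by omega
    simp [h0, h1, h2]

theorem one_sub_X_pow_ne_zero {m : ℕ} (hm : 0 < m) :
    (1 - PowerSeries.X ^ m : PowerSeries ℂ) ≠ 0 := by
  intro h
  have := congrArg (PowerSeries.coeff 0) h
  simp [hm.ne'] at this

/-- The solution of the equation that results from moving an oscillator once around a trace. -/
theorem eq_lambertTerm_mul {m : ℕ} (hm : 0 < m) {T C : PowerSeries ℂ}
    (h : T = PowerSeries.X ^ m * (C + T)) : T = lambertTerm m * C := by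
  apply mul_left_cancel₀ (one_sub_X_pow_ne_zero hm)
  rw [← mul_assoc, one_sub_X_pow_mul_lambertTerm hm]
  linear_combination h

end GradedTrace

/-! ### Normally ordered products of free fields and their traces -/

section Wick

open MvPolynomial Finset

variable {σ : Type*}

/-- The derivation of `ℂ[σ]` with constant values `c x` on the variables. -/
abbrev constDerivation (c : σ → ℂ) : Derivation ℂ (MvPolynomial σ ℂ) (MvPolynomial σ ℂ) :=
  mkDerivation ℂ fun x => C (c x)

theorem constDerivation_comm (c e : σ → ℂ) (p : MvPolynomial σ ℂ) :
    constDerivation c (constDerivation e p) = constDerivation e (constDerivation c p) := by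
  have h : ⁅constDerivation c, constDerivation e⁆ = 0 := by
    apply derivation_ext
    intro i
    simp [Derivation.commutator_apply, mkDerivation_X]
  exact sub_eq_zero.mp (congrArg (fun D => D p) h)

variable (Y : Finset σ) (γ κ : σ → σ → ℂ) (μ : σ → ℂ)

/-- The creation part `∑_{y ∈ Y} γ(x, y) X_y` of the field labelled by `x`. -/
def creationPart (x : σ) : MvPolynomial σ ℂ := ∑ y ∈ Y, γ x y • X y

/-- The annihilation part of the field labelled by `x`, including the zero mode, which acts by the
scalar `μ x`. -/
def annihilationPart (x : σ) : Module.End ℂ (MvPolynomial σ ℂ) :=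
  (constDerivation (κ x)).toLinearMap + μ x • LinearMap.id

theorem annihilationPart_apply (x : σ) (p : MvPolynomial σ ℂ) :
    annihilationPart κ μ x p = constDerivation (κ x) p + μ x • p := rfl

theorem annihilationPart_comm (x y : σ) (p : MvPolynomial σ ℂ) :
    annihilationPart κ μ x (annihilationPart κ μ y p)
      = annihilationPart κ μ y (annihilationPart κ μ x p) := by
  simp only [annihilationPart_apply, map_add, Derivation.map_smul]
  rw [constDerivation_comm, smul_comm]
  abel

/-- The normally ordered product of the field labelled by `x` with the operator `G`. -/
def wickStep (x : σ) (G : Module.End ℂ (MvPolynomial σ ℂ)) : Module.End ℂ (MvPolynomial σ ℂ) :=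
  LinearMap.mulLeft ℂ (creationPart Y γ x) ∘ₗ G + G ∘ₗ annihilationPart κ μ x

theorem wickStep_apply (x : σ) (G : Module.End ℂ (MvPolynomial σ ℂ)) (p : MvPolynomial σ ℂ) :
    wickStep Y γ κ μ x G p = creationPart Y γ x * G p + G (annihilationPart κ μ x p) := rfl

instance wickStep_leftCommutative : LeftCommutative (wickStep Y γ κ μ) where
  left_comm x y G := by
    refine LinearMap.ext fun p => ?_
    simp only [wickStep_apply]
    rw [annihilationPart_comm]
    ring

/-- The normally ordered product `: f :` of the fields with creation parts `creationPart x` and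
annihilation parts `annihilationPart x`, substituted for the variables `X x` of `f`. -/
def wickField : MvPolynomial σ ℂ →ₗ[ℂ] Module.End ℂ (MvPolynomial σ ℂ) :=
  (basisMonomials σ ℂ).constr ℂ fun s =>
    Multiset.foldr (wickStep Y γ κ μ) LinearMap.id (Finsupp.toMultiset s)

theorem wickField_monomial (s : σ →₀ ℕ) :
    wickField Y γ κ μ (monomial s 1)
      = Multiset.foldr (wickStep Y γ κ μ) LinearMap.id (Finsupp.toMultiset s) := by
  have := (basisMonomials σ ℂ).constr_basis ℂ
    (fun s => Multiset.foldr (wickStep Y γ κ μ) LinearMap.id (Finsupp.toMultiset s)) s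
  rwa [coe_basisMonomials] at this

theorem wickField_one : wickField Y γ κ μ 1 = LinearMap.id := by
  have := wickField_monomial Y γ κ μ 0
  simpa using this

theorem wickField_X_mul (x : σ) (f : MvPolynomial σ ℂ) :
    wickField Y γ κ μ (X x * f) = wickStep Y γ κ μ x (wickField Y γ κ μ f) := by
  have h : ∀ c : ℂ, ∀ G, wickStep Y γ κ μ x (c • G) = c • wickStep Y γ κ μ x G := by
    intro c G
    refine LinearMap.ext fun p => ?_
    simp [wickStep_apply]
  induction f using MvPolynomial.induction_on' with
  | monomial s c =>
    have h1 : monomial s c = c • monomial s (1 : ℂ) := by simp [smul_monomial]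
    rw [h1, mul_smul_comm, map_smul, map_smul, h, X, monomial_mul, one_mul, wickField_monomial,
      wickField_monomial, map_add, Finsupp.toMultiset_single, one_smul, Multiset.singleton_add,
      Multiset.foldr_cons]
  | add p q hp hq =>
    rw [mul_add, map_add, hp, hq, map_add]
    refine LinearMap.ext fun p => ?_
    simp only [wickStep_apply, LinearMap.add_apply]
    ring

variable {Y γ κ μ}

/-- The commutator of a normally ordered product with a creation operator. -/
theorem wickField_X_mul_apply (y : σ) (f p : MvPolynomial σ ℂ) :
    wickField Y γ κ μ f (X y * p)
      = X y * wickField Y γ κ μ f p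
        + wickField Y γ κ μ (constDerivation (fun x => κ x y) f) p := by
  induction f using MvPolynomial.induction_on generalizing p with
  | C c =>
    have h : (C c : MvPolynomial σ ℂ) = c • 1 := by rw [smul_eq_C_mul, mul_one]
    simp [h, wickField_one]
  | add f g hf hg =>
    simp only [map_add, LinearMap.add_apply, hf, hg]
    ring
  | mul_X f x hf =>
    have h1 : annihilationPart κ μ x (X y * p)
        = X y * annihilationPart κ μ x p + κ x y • p := by
      simp only [annihilationPart_apply, Derivation.leibniz, mkDerivation_X, smul_eq_mul,
        smul_eq_C_mul]
      ring
    have h2 : constDerivation (fun x => κ x y) (f * X x)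
        = X x * constDerivation (fun x => κ x y) f + κ x y • f := by
      simp only [Derivation.leibniz, mkDerivation_X, smul_eq_mul, smul_eq_C_mul]
      ring
    rw [h2, mul_comm f, wickField_X_mul, map_add, map_smul, wickField_X_mul, LinearMap.add_apply,
      LinearMap.smul_apply, wickStep_apply, wickStep_apply, wickStep_apply, h1, map_add, map_smul,
      hf, hf]
    ring

/-- The commutator of a normally ordered product with an annihilation operator. -/
theorem pderiv_wickField_apply {y : σ} (hy : y ∈ Y) (f p : MvPolynomial σ ℂ) :
    pderiv y (wickField Y γ κ μ f p)
      = wickField Y γ κ μ f (pderiv y p)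
        + wickField Y γ κ μ (constDerivation (fun x => γ x y) f) p := by
  classical
  induction f using MvPolynomial.induction_on generalizing p with
  | C c =>
    have h : (C c : MvPolynomial σ ℂ) = c • 1 := by rw [smul_eq_C_mul, mul_one]
    simp [h, wickField_one]
  | add f g hf hg =>
    simp only [map_add, LinearMap.add_apply, hf, hg]
    ring
  | mul_X f x hf =>
    have h1 : annihilationPart κ μ x (pderiv y p) = pderiv y (annihilationPart κ μ x p) := by
      have h : pderiv y = constDerivation (fun z => if z = y then (1 : ℂ) else 0) := by
        apply derivation_ext
        intro i
        rw [pderiv_X, mkDerivation_X]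
        by_cases hi : i = y <;> simp [hi]
      simp only [annihilationPart_apply, map_add, Derivation.map_smul]
      rw [h, constDerivation_comm]
    have h2 : constDerivation (fun x => γ x y) (f * X x)
        = X x * constDerivation (fun x => γ x y) f + γ x y • f := by
      simp only [Derivation.leibniz, mkDerivation_X, smul_eq_mul, smul_eq_C_mul]
      ring
    have h3 : pderiv y (creationPart Y γ x) = C (γ x y) := by
      rw [creationPart, map_sum]
      simp only [Derivation.map_smul, pderiv_X, Pi.single_apply]
      rw [sum_eq_single_of_mem y hy]
      · simp [smul_eq_C_mul]
      · intro z _ hz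
        simp [hz]
    rw [h2, mul_comm f, wickField_X_mul, map_add, map_smul, wickField_X_mul, LinearMap.add_apply,
      LinearMap.smul_apply, wickStep_apply, wickStep_apply, wickStep_apply, h1, map_add,
      Derivation.leibniz, h3, hf, hf, smul_eq_mul, smul_eq_mul, smul_eq_C_mul]
    ring

/-- A constant-coefficient derivation is a sum of partial derivatives on polynomials in the
variables of `Y`. -/
theorem constDerivation_monomial (c : σ → ℂ) {s : σ →₀ ℕ} (hs : s.support ⊆ Y) :
    constDerivation c (monomial s 1) = ∑ y ∈ Y, c y • pderiv y (monomial s (1 : ℂ)) := by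
  rw [mkDerivation_monomial, Finsupp.sum_of_support_subset _ hs _ (by simp), one_smul]
  refine sum_congr rfl fun y _ => ?_
  rw [pderiv_monomial, smul_eq_mul, mul_comm, smul_eq_C_mul, one_mul]

variable {w : σ → ℕ}

/-- Wick's recursion: the graded trace of a normally ordered product loses one field at a time.
The zero mode contributes its eigenvalue; each oscillator, moved once around the trace, contributes
its commutator with the remaining product, weighted by `q^m / (1 - q^m)`. -/
theorem gradedTrace_wickField_X_mul (hw : ∀ y, 0 < w y) (x : σ) (f : MvPolynomial σ ℂ) :
    gradedTrace Y w (wickField Y γ κ μ (X x * f))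
      = μ x • gradedTrace Y w (wickField Y γ κ μ f)
        + ∑ y ∈ Y, lambertTerm (w y) *
          (γ x y • gradedTrace Y w (wickField Y γ κ μ (constDerivation (fun z => κ z y) f))
          + κ x y • gradedTrace Y w
              (wickField Y γ κ μ (constDerivation (fun z => γ z y) f))) := by
  set F := wickField Y γ κ μ f with hF
  have h1 : gradedTrace Y w (wickField Y γ κ μ (X x * f))
      = gradedTrace Y w (∑ y ∈ Y, γ x y • (LinearMap.mulLeft ℂ (X y) ∘ₗ F)
        + ∑ y ∈ Y, κ x y • (F ∘ₗ (pderiv y).toLinearMap) + μ x • F) := by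
    refine gradedTrace_congr hw fun s hs => ?_
    rw [wickField_X_mul, wickStep_apply, annihilationPart_apply, constDerivation_monomial _ hs]
    simp only [creationPart, sum_mul, map_add, map_sum, map_smul, LinearMap.add_apply,
      LinearMap.sum_apply, LinearMap.smul_apply, LinearMap.comp_apply, LinearMap.mulLeft_apply,
      smul_mul_assoc, Derivation.coeFn_coe, add_assoc, hF]
  have h2 : ∀ y ∈ Y, gradedTrace Y w (LinearMap.mulLeft ℂ (X y) ∘ₗ F) = lambertTerm (w y) *
      gradedTrace Y w (wickField Y γ κ μ (constDerivation (fun z => κ z y) f)) := by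
    intro y hy
    apply eq_lambertTerm_mul (hw y)
    rw [← map_add, gradedTrace_mulLeft_comp hw hy]
    congr 2
    refine LinearMap.ext fun p => ?_
    rw [LinearMap.comp_apply, LinearMap.mulLeft_apply, hF, wickField_X_mul_apply, add_comm]
    rfl
  have h3 : ∀ y ∈ Y, gradedTrace Y w (F ∘ₗ (pderiv y).toLinearMap) = lambertTerm (w y) *
      gradedTrace Y w (wickField Y γ κ μ (constDerivation (fun z => γ z y) f)) := by
    intro y hy
    apply eq_lambertTerm_mul (hw y)
    rw [← map_add, gradedTrace_comp_pderiv hw hy]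
    congr 2
    refine LinearMap.ext fun p => ?_
    rw [LinearMap.comp_apply, Derivation.coeFn_coe, hF, pderiv_wickField_apply hy, add_comm]
    rfl
  rw [h1, map_add, map_add, map_sum, map_sum, map_smul, add_comm, ← sum_add_distrib]
  congr 1
  refine sum_congr rfl fun y hy => ?_
  rw [map_smul, map_smul, h2 y hy, h3 y hy, mul_add, mul_smul_comm, mul_smul_comm]

/-- The graded dimension of the polynomial algebra on the variables of `Y`. -/
theorem gradedTrace_id_mul_prod [DecidableEq σ] (hw : ∀ y, 0 < w y) (Y : Finset σ) :
    gradedTrace Y w LinearMap.id * ∏ y ∈ Y, (1 - PowerSeries.X ^ w y) = 1 := by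
  have hco : ∀ (Y : Finset σ) (N : ℕ), PowerSeries.coeff N (gradedTrace Y w LinearMap.id)
      = ∑ s ∈ weightExponents Y w N, 1 := by
    intro Y N
    rw [coeff_gradedTrace]
    exact sum_congr rfl fun s _ => by simp
  induction Y using Finset.induction_on with
  | empty =>
    rw [prod_empty, mul_one]
    ext N
    rw [hco, PowerSeries.coeff_one]
    have : weightExponents ∅ w N = if N = 0 then {0} else ∅ := by
      ext s
      rw [mem_weightExponents hw, subset_empty, Finsupp.support_eq_empty]
      split_ifs with h
      · rw [mem_singleton, h, and_iff_left_of_imp]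
        rintro rfl
        exact map_zero _
      · simp only [notMem_empty, iff_false, not_and]
        rintro rfl
        rw [map_zero]
        exact Ne.symm h
    rw [this]
    split_ifs <;> simp
  | insert y Y hy ih =>
    rw [prod_insert hy, ← mul_assoc]
    refine Eq.trans ?_ ih
    congr 1
    rw [mul_sub, mul_one, sub_eq_iff_eq_add, mul_comm _ (PowerSeries.X ^ w y)]
    ext N
    rw [map_add, PowerSeries.coeff_X_pow_mul', hco, hco, hco]
    rw [← sum_weightExponents_shift hw (mem_insert_self y Y) N (fun _ => (1 : ℂ))]
    have hfilter : weightExponents Y w N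
        = (weightExponents (insert y Y) w N).filter fun s => s y = 0 := by
      ext s
      rw [mem_filter, mem_weightExponents hw, mem_weightExponents hw, and_right_comm,
        ← Finsupp.notMem_support_iff]
      refine and_congr_left' ⟨fun h => ⟨h.trans (subset_insert _ _), fun h' => hy (h h')⟩,
        fun h z hz => ?_⟩
      rcases mem_insert.1 (h.1 hz) with rfl | h'
      · exact absurd hz h.2
      · exact h'
    -- a monomial either does not involve `y`, or is `X y` times a monomial of smaller weight
    rw [hfilter, sum_filter, ← sum_add_distrib]
    refine sum_congr rfl fun s _ => ?_
    split_ifs <;> simp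

end Wick

/-! ### Residues of powers of the logarithm -/

section LogResidues

open PowerSeries Finset

/-- The series `log (1 + w) / w`. -/
def logQuot : PowerSeries ℂ := PowerSeries.mk fun n => (-1 : ℂ) ^ n / (n + 1)

/-- The series `w / log (1 + w)`. -/
def invLogQuot : PowerSeries ℂ := logQuot⁻¹

/-- The series `1 / (1 + w)`. -/
def invOneAdd : PowerSeries ℂ := PowerSeries.mk fun n => (-1 : ℂ) ^ n

theorem invLogQuot_mul_logQuot : invLogQuot * logQuot = 1 :=
  PowerSeries.inv_mul_cancel _ (by simp [logQuot])

theorem constantCoeff_invLogQuot : constantCoeff invLogQuot = 1 := by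
  simp [invLogQuot, logQuot]

theorem one_add_X_mul_invOneAdd : (1 + X) * invOneAdd = 1 := by
  ext n
  rw [add_mul, one_mul, map_add, coeff_one]
  cases n with
  | zero => simp [invOneAdd]
  | succ n => simp [invOneAdd, coeff_succ_X_mul, pow_succ]

/-- The derivative of `log (1 + w)` is `1 / (1 + w)`. -/
theorem one_add_X_mul_derivative_log : (1 + X) * d⁄dX ℂ (X * logQuot) = 1 := by
  have h : d⁄dX ℂ (X * logQuot) = invOneAdd := by
    ext n
    rw [coeff_derivative, coeff_succ_X_mul, logQuot, invOneAdd, coeff_mk, coeff_mk]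
    exact div_mul_cancel₀ _ (by exact_mod_cast n.succ_ne_zero)
  rw [h, one_add_X_mul_invOneAdd]

/-- The logarithmic derivative of `w / log (1 + w)`. -/
theorem X_mul_derivative_invLogQuot :
    (1 + X) * (X * d⁄dX ℂ invLogQuot) = (1 + X) * invLogQuot - invLogQuot ^ 2 := by
  have h1 := one_add_X_mul_derivative_log
  have h2 := congrArg (d⁄dX ℂ) invLogQuot_mul_logQuot
  have h3 := invLogQuot_mul_logQuot
  rw [Derivation.leibniz] at h1 h2
  simp only [smul_eq_mul, Derivation.map_one_eq_zero, derivative_X, mul_one] at h1 h2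
  set W := invLogQuot
  set U := logQuot
  set W' := d⁄dX ℂ W
  set U' := d⁄dX ℂ U
  have h4 : W' = -U' * W ^ 2 := by linear_combination W * h2 - W' * h3
  have h5 : W = W ^ 2 * U := by linear_combination -W * h3
  rw [h4]
  linear_combination (-(W ^ 2)) * h1 - (1 + X) * h5

/-- The residue of `(log (1 + w))^(-n-1) (1 + w)^(m-1)` is `m^n / n!`, which is a formal version of
the substitution `1 + w = e^z`. The power `e = (1 + w)^(m-1)` enters through its differential
equation, so that `m` may be any complex number. -/
theorem coeff_invLogQuot_pow_mul {m : ℂ} {e : PowerSeries ℂ} (he0 : constantCoeff e = 1)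
    (he : (1 + X) * d⁄dX ℂ e = (m - 1) • e) (n : ℕ) :
    coeff n (invLogQuot ^ (n + 1) * e) = m ^ n / n.factorial := by
  induction n with
  | zero => simp [constantCoeff_invLogQuot, he0]
  | succ n ih =>
    -- the coefficient of `w^(n+1)` in `w h' - (n + 1) h` vanishes for every series `h`
    have key : X * d⁄dX ℂ (invLogQuot ^ (n + 1) * ((1 + X) * e))
        = ((n + 1 : ℕ) : ℂ) • (invLogQuot ^ (n + 1) * ((1 + X) * e))
          - ((n + 1 : ℕ) : ℂ) • (invLogQuot ^ (n + 1 + 1) * e)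
          + m • (X * (invLogQuot ^ (n + 1) * e)) := by
      have h := X_mul_derivative_invLogQuot
      rw [Derivation.leibniz, Derivation.leibniz, Derivation.leibniz_pow]
      simp only [smul_eq_mul, map_add, Derivation.map_one_eq_zero, derivative_X, zero_add,
        smul_eq_C_mul, nsmul_eq_mul, Nat.add_sub_cancel] at he ⊢
      rw [map_sub, map_one] at he
      rw [map_natCast]
      linear_combination (invLogQuot ^ (n + 1) * X) * he
        + (((n + 1 : ℕ) : PowerSeries ℂ) * invLogQuot ^ n * e) * h
    have := congrArg (coeff (n + 1)) key
    rw [coeff_succ_X_mul, coeff_derivative, map_add, map_sub, coeff_smul, coeff_smul, coeff_smul,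
      coeff_succ_X_mul, ih, smul_eq_mul, smul_eq_mul, smul_eq_mul] at this
    have hn : ((n + 1 : ℕ) : ℂ) ≠ 0 := by exact_mod_cast n.succ_ne_zero
    have hf : (n.factorial : ℂ) ≠ 0 := by exact_mod_cast n.factorial_ne_zero
    apply mul_left_cancel₀ hn
    rw [Nat.factorial_succ, Nat.cast_mul]
    field_simp
    field_simp at this
    push_cast at this ⊢
    linear_combination this

/-- The exponential series of `log (1 + w)`, truncated. -/
theorem X_pow_dvd_exp_log_sub (n : ℕ) :
    (X : PowerSeries ℂ) ^ (n + 1) ∣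
      ∑ j ∈ range (n + 1), ((j.factorial : ℂ)⁻¹) • (X * logQuot) ^ j - (1 + X) := by
  induction n with
  | zero => simp
  | succ n ih =>
    set D := ∑ j ∈ range (n + 1 + 1), ((j.factorial : ℂ)⁻¹) • (X * logQuot) ^ j - (1 + X) with hD
    have h1 : (1 + X) * d⁄dX ℂ D
        = ∑ j ∈ range (n + 1), ((j.factorial : ℂ)⁻¹) • (X * logQuot) ^ j - (1 + X) := by
      rw [hD, sum_range_succ']
      simp only [map_sub, map_add, map_sum, Derivation.map_smul, Derivation.leibniz_pow, pow_zero,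
        Derivation.map_one_eq_zero, derivative_X, smul_zero, add_zero, zero_add, mul_sub, mul_one,
        mul_sum]
      congr 1
      refine sum_congr rfl fun j _ => ?_
      have hC : ((j + 1 : ℕ) : PowerSeries ℂ) * C (((j + 1).factorial : ℂ)⁻¹)
          = C ((j.factorial : ℂ)⁻¹) := by
        rw [← map_natCast (C (R := ℂ)), ← map_mul, Nat.factorial_succ, Nat.cast_mul, mul_inv,
          mul_inv_cancel_left₀ (by exact_mod_cast j.succ_ne_zero)]
      simp only [Nat.add_sub_cancel, smul_eq_C_mul, smul_eq_mul, nsmul_eq_mul]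
      linear_combination (C (((j + 1).factorial : ℂ)⁻¹) * ((j + 1 : ℕ) : PowerSeries ℂ)
        * (X * logQuot) ^ j) * one_add_X_mul_derivative_log + (X * logQuot) ^ j * hC
    have h2 : (X : PowerSeries ℂ) ^ (n + 1) ∣ d⁄dX ℂ D := by
      have : d⁄dX ℂ D = invOneAdd * ((1 + X) * d⁄dX ℂ D) := by
        rw [← mul_assoc, mul_comm invOneAdd, one_add_X_mul_invOneAdd, one_mul]
      rw [this, h1]
      exact ih.mul_left _
    rw [X_pow_dvd_iff] at h2 ⊢
    intro k hk
    cases k with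
    | zero =>
      rw [hD, sum_range_succ']
      simp
    | succ k =>
      have := h2 k (by omega)
      rw [coeff_derivative] at this
      exact (mul_eq_zero.1 this).resolve_right (by exact_mod_cast k.succ_ne_zero)

/-- The residue of `(log (1 + w))^(-n) / (w (1 + w))` is `B_n / n!`, the coefficient of `z^(n-1)` in
`1 / (e^z - 1)`. -/
theorem coeff_invLogQuot_pow_mul_invOneAdd (n : ℕ) :
    coeff n (invLogQuot ^ n * invOneAdd) = ((bernoulli n : ℚ) : ℂ) / n.factorial := by
  -- Expanding `w = ∑_{j ≥ 1} log (1 + w)^j / j!` in the residue of `log (1 + w)^(-n-1) / (1 + w)`,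
  -- which is known, gives the recursion of the Bernoulli numbers.
  have hrec : ∀ n : ℕ, (∑ k ∈ range (n + 1), ((n + 1 - k).factorial : ℂ)⁻¹ *
      coeff k (invLogQuot ^ k * invOneAdd)) = if n + 1 = 1 then 1 else 0 := by
    intro n
    -- the case `m = 0` of `coeff_invLogQuot_pow_mul`
    have h0 : coeff n (invLogQuot ^ (n + 1) * invOneAdd) = (0 : ℂ) ^ n / n.factorial := by
      refine coeff_invLogQuot_pow_mul (by simp [invOneAdd]) ?_ n
      have h := congrArg (d⁄dX ℂ) one_add_X_mul_invOneAdd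
      rw [Derivation.leibniz] at h
      simp only [smul_eq_mul, map_add, Derivation.map_one_eq_zero, derivative_X, zero_add] at h
      rw [zero_sub, neg_smul, one_smul]
      linear_combination h
    obtain ⟨g, hg⟩ := X_pow_dvd_exp_log_sub (n + 1)
    rw [sum_range_succ'] at hg
    have h1 : X * (invLogQuot ^ (n + 1) * invOneAdd)
        = ∑ j ∈ range (n + 1), (((j + 1).factorial : ℂ)⁻¹) •
            (X ^ (j + 1) * (invLogQuot ^ (n - j) * invOneAdd))
          - X ^ (n + 1 + 1) * (g * (invLogQuot ^ (n + 1) * invOneAdd)) := by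
      have h2 : ∑ j ∈ range (n + 1), (((j + 1).factorial : ℂ)⁻¹) •
            (X ^ (j + 1) * (invLogQuot ^ (n - j) * invOneAdd))
          = (∑ j ∈ range (n + 1), (((j + 1).factorial : ℂ)⁻¹) • (X * logQuot) ^ (j + 1))
            * (invLogQuot ^ (n + 1) * invOneAdd) := by
        rw [sum_mul]
        refine sum_congr rfl fun j hj => ?_
        have hj' : n + 1 = (n - j) + (j + 1) := by
          have := mem_range.1 hj
          omega
        rw [smul_mul_assoc]
        congr 1
        rw [hj', pow_add invLogQuot, mul_pow]
        have h3 : logQuot ^ (j + 1) * invLogQuot ^ (j + 1) = 1 := by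
          rw [← mul_pow, mul_comm, invLogQuot_mul_logQuot, one_pow]
        linear_combination (-(X ^ (j + 1) * (invLogQuot ^ (n - j) * invOneAdd))) * h3
      rw [h2]
      simp only [pow_zero, Nat.factorial_zero, Nat.cast_one, inv_one, one_smul] at hg
      linear_combination (-(invLogQuot ^ (n + 1) * invOneAdd)) * hg
    have h2 := congrArg (coeff (n + 1)) h1
    rw [coeff_succ_X_mul, h0, map_sub, coeff_X_pow_mul', if_neg (by omega), sub_zero, map_sum] at h2
    rw [← sum_range_reflect]
    have h3 : ((0 : ℂ) ^ n / n.factorial) = if n + 1 = 1 then 1 else 0 := by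
      cases n <;> simp
    rw [← h3, h2]
    refine sum_congr rfl fun j hj => ?_
    have hj' := mem_range.1 hj
    rw [coeff_smul, coeff_X_pow_mul', if_pos (by omega), smul_eq_mul,
      show n + 1 - (n + 1 - 1 - j) = j + 1 by omega, show n + 1 - 1 - j = n - j by omega,
      show n + 1 - (j + 1) = n - j by omega]
  induction n using Nat.strong_induction_on with
  | _ n ih =>
    have h1 := hrec n
    have h2 := congrArg (fun q : ℚ => (q : ℂ)) (sum_bernoulli (n + 1))
    have h4 : ∀ k ∈ range (n + 1), (((n + 1).choose k : ℚ) * bernoulli k : ℚ)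
        = ((n + 1).factorial : ℂ) * (((n + 1 - k).factorial : ℂ)⁻¹ *
          (((bernoulli k : ℚ) : ℂ) / k.factorial)) := by
      intro k hk
      have hk' : k ≤ n + 1 := (mem_range.1 hk).le
      have h5 : ((n + 1).choose k : ℂ) * k.factorial * (n + 1 - k).factorial
          = (n + 1).factorial := by exact_mod_cast Nat.choose_mul_factorial_mul_factorial hk'
      have hf : (k.factorial : ℂ) ≠ 0 := by exact_mod_cast k.factorial_ne_zero
      have hf' : ((n + 1 - k).factorial : ℂ) ≠ 0 := by exact_mod_cast Nat.factorial_ne_zero _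
      rw [← h5]
      push_cast
      field_simp
    simp only [Rat.cast_sum] at h2
    rw [sum_congr rfl h4, ← mul_sum] at h2
    have h6 : (((if n + 1 = 1 then 1 else 0 : ℚ)) : ℂ)
        = ((n + 1).factorial : ℂ) * (if n + 1 = 1 then 1 else 0) := by
      cases n <;> simp
    rw [h6, ← h1] at h2
    have hf : ((n + 1).factorial : ℂ) ≠ 0 := by exact_mod_cast Nat.factorial_ne_zero _
    have h7 := mul_left_cancel₀ hf h2
    rw [sum_range_succ, sum_range_succ, sum_congr rfl fun k hk => by
      rw [← ih k (mem_range.1 hk)]] at h7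
    have h8 := add_left_cancel h7
    simpa using h8.symm

/-- The coefficient of `w` in `(log (1 + w))^(-r)`. -/
theorem coeff_succ_invLogQuot_pow (r : ℕ) :
    coeff (r + 1) (invLogQuot ^ r)
      = -r * ((bernoulli (r + 1) : ℚ) : ℂ) / (r + 1).factorial := by
  rw [mul_div_assoc, ← coeff_invLogQuot_pow_mul_invOneAdd]
  cases r with
  | zero => simp [coeff_one]
  | succ r =>
    have key : X * d⁄dX ℂ (invLogQuot ^ (r + 1))
        = ((r + 1 : ℕ) : ℂ) • invLogQuot ^ (r + 1)
          - ((r + 1 : ℕ) : ℂ) • (invLogQuot ^ (r + 1 + 1) * invOneAdd) := by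
      have h := X_mul_derivative_invLogQuot
      have h' := one_add_X_mul_invOneAdd
      rw [Derivation.leibniz_pow]
      simp only [smul_eq_C_mul, nsmul_eq_mul, Nat.add_sub_cancel, smul_eq_mul]
      rw [map_natCast]
      linear_combination (invOneAdd * ((r + 1 : ℕ) : PowerSeries ℂ) * invLogQuot ^ r) * h
        + (((r + 1 : ℕ) : PowerSeries ℂ) * invLogQuot ^ r *
          (invLogQuot - X * d⁄dX ℂ invLogQuot)) * h'
    have := congrArg (coeff (r + 1 + 1)) key
    rw [coeff_succ_X_mul, coeff_derivative, map_sub, coeff_smul, coeff_smul] at this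
    push_cast at this ⊢
    rw [smul_eq_mul, smul_eq_mul] at this
    linear_combination this

end LogResidues

/-! ### Laurent coefficients -/

section LaurentCoefficients

open Finset

/-- A coefficient of a product of series, computed over any finite range of exponents that
contains all contributions. -/
theorem map_coeff_hahn_smul {R W A : Type*} [CommRing R] [AddCommGroup W] [Module R W]
    [AddCommGroup A] (φ : W →+ A) (x : LaurentSeries R) (y : HahnModule ℤ R W) (a : ℤ)
    (J : Finset ℤ)
    (hJ : ∀ k ∉ J, φ (x.coeff k • ((HahnModule.of R).symm y).coeff (a - k)) = 0) :
    φ (((HahnModule.of R).symm (x • y)).coeff a)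
      = ∑ k ∈ J, φ (x.coeff k • ((HahnModule.of R).symm y).coeff (a - k)) := by
  have hmem : ∀ ij : ℤ × ℤ, ij ∈ VAddAntidiagonal a
      (Set.VAddAntidiagonal.finite_of_isPWO x.isPWO_support
        ((HahnModule.of R).symm y).isPWO_support a) →
      ij.2 = a - ij.1 := by
    intro ij h
    have h1 := (mem_vaddAntidiagonal a _).1 h
    have h2 : ij.1 + ij.2 = a := h1.2.2
    omega
  rw [HahnModule.coeff_smul, map_sum]
  refine sum_bij_ne_zero (fun ij _ _ => ij.1) ?_ ?_ ?_ ?_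
  · intro ij h hne
    by_contra hk
    rw [hmem ij h] at hne
    exact hne (hJ _ hk)
  · intro ij h _ ij' h' _ heq
    exact Prod.ext heq (by rw [hmem ij h, hmem ij' h', heq])
  · intro k hk hne
    refine ⟨(k, a - k), ?_, hne, rfl⟩
    refine (mem_vaddAntidiagonal a _).2 ⟨?_, ?_, ?_⟩
    · intro h0
      exact hne (by rw [h0, zero_smul, map_zero])
    · intro h0
      exact hne (by rw [h0, smul_zero, map_zero])
    · exact add_sub_cancel k a
  · intro ij h _
    rw [hmem ij h]

theorem map_coeff_ofPowerSeries_mul {R A : Type*} [CommRing R] [AddCommGroup A] (φ : R →+ A)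
    (f : PowerSeries R) (G : LaurentSeries R) (a : ℤ) (K : ℕ)
    (hK : ∀ k, K ≤ k → φ (PowerSeries.coeff k f * G.coeff (a - k)) = 0) :
    φ ((HahnSeries.ofPowerSeries ℤ R f * G).coeff a)
      = ∑ k ∈ range K, φ (PowerSeries.coeff k f * G.coeff (a - k)) := by
  have := map_coeff_hahn_smul φ (HahnSeries.ofPowerSeries ℤ R f) (HahnModule.of R G) a
    ((range K).map Nat.castEmbedding) ?_
  · rw [HahnSeries.of_symm_smul_of_eq_mul, sum_map] at this
    simpa using this
  · intro k hk
    rw [Equiv.symm_apply_apply]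
    rcases lt_or_ge k 0 with h | h
    · rw [PowerSeries.coeff_coe, if_pos h, zero_smul, map_zero]
    · lift k to ℕ using h
      rw [PowerSeries.coeff_coe, if_neg (by omega), Int.natAbs_natCast, smul_eq_mul]
      exact hK k (by simpa using hk)

end LaurentCoefficients

/-! ### Fields of charge zero, specialised to `z = 1` -/

section SectorField

open MvPolynomial Finset

variable {d : ℕ} {Λ : Type*} [AddCommGroup Λ]

/-- The weight `n + 1` of the creation operator `(b i)(-n-1)`, as a natural number. -/
def oscLevel (y : Fin d × ℕ) : ℕ := y.2 + 1

theorem oscLevel_pos (y : Fin d × ℕ) : 0 < oscLevel y := Nat.succ_pos _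

/-- The weight of a monomial. -/
abbrev wt (s : Fin d × ℕ →₀ ℕ) : ℕ := Finsupp.weight oscLevel s

/-- The variables `(b i)(-n-1)` with `n < M`. -/
def modeVars (d M : ℕ) : Finset (Fin d × ℕ) := univ ×ˢ range M

theorem mem_modeVars {M : ℕ} {y : Fin d × ℕ} : y ∈ modeVars d M ↔ y.2 < M := by
  simp [modeVars]

/-- The coefficient of the creation operator `y` in `(1/n!) ∂_zⁿ (b i)(z)` at `z = 1`. -/
def creationCoeff (x y : Fin d × ℕ) : ℂ := if y.1 = x.1 then (y.2.choose x.2 : ℂ) else 0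

/-- The value of the annihilation part of `(1/n!) ∂_zⁿ (b i)(z)` at `z = 1` on the variable `y`. -/
def annihilationCoeff (B : LinearMap.BilinForm ℤ Λ) (b : Module.Basis (Fin d) ℤ Λ)
    (x y : Fin d × ℕ) : ℂ :=
  (-1) ^ x.2 * ((y.2 + 1 + x.2).choose x.2 : ℂ) * (y.2 + 1) * (B (b x.1) (b y.1) : ℂ)

/-- The zero mode of `(1/n!) ∂_zⁿ (b i)(z)` at `z = 1` on the sector `S ⊗ e^α`. -/
def zeroModeCoeff (B : LinearMap.BilinForm ℤ Λ) (b : Module.Basis (Fin d) ℤ Λ) (α : Λ)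
    (x : Fin d × ℕ) : ℂ := (-1) ^ x.2 * (B (b x.1) α : ℂ)

/-- For `β = 0` all exponential factors of the field of `1 ⊗ e^β` are trivial. -/
theorem expField_zero_apply (B : LinearMap.BilinForm ℤ Λ) (b : Module.Basis (Fin d) ℤ Λ) (α : Λ)
    (p : HeisZ d) : expField B b 0 α p = toLaurent d p := by
  have h1 : expCreation b (0 : Λ) = 1 := by
    have h0 : (PowerSeries.mk fun n => if n = 0 then (0 : Heis d) else
      ∑ i : Fin d, ((b.repr (0 : Λ) i : ℂ) / n) • (X (i, n - 1) : Heis d)) = 0 := by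
      ext1 n
      simp
    rw [expCreation, h0]
    ext1 n
    rw [PowerSeries.coeff_mk, sum_range_succ']
    simp
  have h2 : expAnnihilation B b (0 : Λ) = AlgHom.id (Polynomial ℂ) (HeisZ d) := by
    apply MvPolynomial.algHom_ext
    intro y
    simp [expAnnihilation]
  have h3 : cocycle B b (0 : Λ) α = 1 := by simp [cocycle]
  change HahnSeries.single (B 0 α) (C (cocycle B b 0 α) : Heis d)
      * HahnSeries.ofPowerSeries ℤ (Heis d) (expCreation b 0)
      * toLaurent d (expAnnihilation B b 0 p) = _
  rw [h1, h2, h3]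
  simp

theorem toLaurent_monomial (s : Fin d × ℕ →₀ ℕ) (i : ℕ) (c : ℂ) :
    toLaurent d (monomial s (Polynomial.monomial i c))
      = HahnSeries.single (-i : ℤ) (monomial s c) := by
  rw [toLaurent, coe_eval₂Hom, eval₂_monomial, monomial_eq (a := c)]
  have h : (s.prod fun x n => (HahnSeries.C (X x) : LaurentSeries (Heis d)) ^ n)
      = HahnSeries.C (s.prod fun x n => (X x : Heis d) ^ n) := by
    rw [map_finsuppProd]
    simp only [map_pow]
  rw [h, Polynomial.coe_eval₂RingHom, Polynomial.eval₂_monomial, HahnSeries.single_pow,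
    HahnSeries.C_apply, RingHom.comp_apply, HahnSeries.C_apply, HahnSeries.single_mul_single,
    HahnSeries.single_mul_single]
  simp

theorem annihilation_monomial (B : LinearMap.BilinForm ℤ Λ) (b : Module.Basis (Fin d) ℤ Λ)
    (α : Λ) (x : Fin d × ℕ) (s : Fin d × ℕ →₀ ℕ) (i : ℕ) :
    annihilation B b α x (monomial s (Polynomial.X ^ i))
      = ∑ y ∈ s.support, (annihilationCoeff B b x y * s y) •
          monomial (s - Finsupp.single y 1) (Polynomial.X ^ (i + (y.2 + x.2 + 2)))
        + zeroModeCoeff B b α x • monomial s (Polynomial.X ^ (i + (x.2 + 1))) := by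
  rw [annihilation, LinearMap.add_apply, LinearMap.smul_apply, LinearMap.id_apply,
    Derivation.coeFn_coe, mkDerivation_monomial, Finsupp.sum, smul_sum]
  congr 1
  · refine sum_congr rfl fun y _ => ?_
    rw [smul_eq_mul, mul_comm (monomial _ _), C_mul_monomial, smul_monomial, smul_monomial]
    congr 1
    rw [annihilationCoeff, ← Polynomial.C_mul_X_pow_eq_monomial, Polynomial.smul_eq_C_mul,
      smul_eq_mul]
    simp only [map_mul, map_natCast]
    ring
  · rw [smul_monomial, smul_monomial]
    congr 1
    rw [zeroModeCoeff, ← Polynomial.C_mul_X_pow_eq_monomial, Polynomial.smul_eq_C_mul,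
      smul_eq_mul]
    ring

theorem wt_sub_single {t : Fin d × ℕ →₀ ℕ} {y : Fin d × ℕ} (hy : y ∈ t.support) :
    wt t = wt (t - Finsupp.single y 1) + (y.2 + 1) := by
  have h : t - Finsupp.single y 1 + Finsupp.single y 1 = t :=
    tsub_add_cancel_of_le (Finsupp.single_le_iff.2
      (Nat.one_le_iff_ne_zero.2 (Finsupp.mem_support_iff.1 hy)))
  conv_lhs => rw [← h, wt, map_add, Finsupp.weight_apply oscLevel (Finsupp.single y 1)]
  simp [oscLevel]

/-- Only the finitely many variables of level at most `wt t` contribute to the coefficient of the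
monomial `t` in a product with a creation part. -/
theorem coeff_creation_mul (x : Fin d × ℕ) (G : LaurentSeries (Heis d)) (j : ℤ) {M : ℕ}
    {t : Fin d × ℕ →₀ ℕ} (ht : wt t ≤ M) :
    coeff t ((creation x * G).coeff j)
      = ∑ y ∈ modeVars d M, creationCoeff x y *
          coeff t (X y * G.coeff (j - (y.2 - x.2 : ℤ))) := by
  classical
  have h := map_coeff_ofPowerSeries_mul (coeffAddMonoidHom t) (PowerSeries.mk fun k =>
      ((x.2 + k).choose x.2 : ℂ) • (X (x.1, x.2 + k) : Heis d)) G j (M - x.2) ?_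
  · simp only [coeffAddMonoidHom_apply] at h
    rw [creation, h, modeVars, sum_product, sum_eq_single_of_mem x.1 (mem_univ _)]
    · simp only [creationCoeff, if_true, PowerSeries.coeff_mk, smul_mul_assoc, coeff_smul,
        smul_eq_mul]
      rcases le_or_gt x.2 M with hx | hx
      · conv_rhs => rw [← Nat.add_sub_cancel' hx, sum_range_add]
        have h0 : ∑ l ∈ range x.2, (l.choose x.2 : ℂ) *
            coeff t (X (x.1, l) * G.coeff (j - (l - x.2 : ℤ))) = 0 := by
          refine sum_eq_zero fun l hl => ?_
          rw [Nat.choose_eq_zero_of_lt (mem_range.1 hl), Nat.cast_zero, zero_mul]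
        rw [h0, zero_add]
        refine sum_congr rfl fun k _ => ?_
        congr 4
        push_cast
        ring
      · rw [Nat.sub_eq_zero_of_le hx.le, sum_range_zero]
        symm
        refine sum_eq_zero fun l hl => ?_
        rw [Nat.choose_eq_zero_of_lt ((mem_range.1 hl).trans hx)]
        simp
    · intro i _ hi
      refine sum_eq_zero fun l _ => ?_
      simp [creationCoeff, hi]
  · intro k hk
    rw [coeffAddMonoidHom_apply, PowerSeries.coeff_mk, smul_mul_assoc, coeff_smul, coeff_X_mul',
      if_neg, smul_zero]
    intro hy
    have := wt_sub_single hy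
    simp only at this
    omega

theorem sum_ite_zero_const {ι A : Type*} [AddCommMonoid A] (s : Finset ι) (P : Prop) [Decidable P]
    (f : ι → A) : ∑ i ∈ s, (if P then f i else 0) = if P then ∑ i ∈ s, f i else 0 := by
  split_ifs <;> simp

theorem constDerivation_monomial_eq_sum {σ : Type*} (c : σ → ℂ) (s : σ →₀ ℕ) :
    constDerivation c (monomial s 1)
      = ∑ y ∈ s.support, (c y * s y) • monomial (s - Finsupp.single y 1) (1 : ℂ) := by
  rw [mkDerivation_monomial, Finsupp.sum, one_smul]
  refine sum_congr rfl fun y _ => ?_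
  rw [smul_eq_mul, mul_comm (monomial _ _), C_mul_monomial, smul_monomial, smul_eq_mul, mul_one]

/-- The modes of a normally ordered product of fields are the homogeneous components of its
value at `z = 1`. The power `X ^ i` of `z⁻¹` is there because annihilation operators produce
negative powers of `z` before the remaining fields act. -/
theorem coeff_foldr_normalOrder (B : LinearMap.BilinForm ℤ Λ) (b : Module.Basis (Fin d) ℤ Λ)
    (α : Λ) {M : ℕ} (m : Multiset (Fin d × ℕ)) (s t : Fin d × ℕ →₀ ℕ) (i : ℕ) (j : ℤ)
    (ht : wt t ≤ M) :
    coeff t ((Multiset.foldr (normalOrder B b α) (expField B b 0 α) m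
        (monomial s (Polynomial.X ^ i))).coeff j)
      = if (wt t : ℤ) = wt s + (m.map oscLevel).sum + j + i then
          coeff t (Multiset.foldr (wickStep (modeVars d M) creationCoeff (annihilationCoeff B b)
            (zeroModeCoeff B b α)) LinearMap.id m (monomial s 1))
        else 0 := by
  classical
  induction m using Multiset.induction_on generalizing s t i j with
  | empty =>
    rw [Multiset.foldr_zero, Multiset.foldr_zero, expField_zero_apply,
      ← Polynomial.monomial_one_right_eq_X_pow, toLaurent_monomial, LinearMap.id_apply,
      HahnSeries.coeff_single, Multiset.map_zero, Multiset.sum_zero, coeff_monomial]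
    by_cases hts : s = t
    · subst hts
      rw [if_pos rfl]
      by_cases hj : j = -i
      · rw [if_pos hj, if_pos (by rw [hj]; push_cast; ring), coeff_monomial, if_pos rfl]
      · rw [if_neg hj, if_neg (by push_cast; omega), coeff_zero]
    · rw [if_neg hts, ite_self]
      split_ifs
      · rw [coeff_monomial, if_neg hts]
      · rw [coeff_zero]
  | cons x m ih =>
    set F := Multiset.foldr (normalOrder B b α) (expField B b 0 α) m with hF
    set G := Multiset.foldr (wickStep (modeVars d M) creationCoeff (annihilationCoeff B b)
            (zeroModeCoeff B b α)) LinearMap.id m with hG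
    rw [Multiset.foldr_cons, Multiset.foldr_cons, wickStep_apply, annihilationPart_apply,
      ← hF, ← hG]
    change coeff t ((creation x * F (monomial s (Polynomial.X ^ i))
      + F (annihilation B b α x (monomial s (Polynomial.X ^ i)))).coeff j) = _
    rw [HahnSeries.coeff_add, coeff_add, coeff_add, coeff_creation_mul x _ _ ht]
    have h1 : ∑ y ∈ modeVars d M, creationCoeff x y *
          coeff t (X y * (F (monomial s (Polynomial.X ^ i))).coeff (j - (y.2 - x.2 : ℤ)))
        = if (wt t : ℤ) = wt s + ((x ::ₘ m).map oscLevel).sum + j + i then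
          coeff t (creationPart (modeVars d M) creationCoeff x * G (monomial s 1)) else 0 := by
      rw [creationPart, sum_mul, coeff_sum, ← sum_ite_zero_const]
      refine sum_congr rfl fun y _ => ?_
      rw [smul_mul_assoc, coeff_smul, coeff_X_mul', coeff_X_mul', smul_eq_mul]
      by_cases hy : y ∈ t.support
      · have hw := wt_sub_single hy
        rw [if_pos hy, if_pos hy, ih s _ i _ (by omega), mul_ite, mul_zero]
        refine if_congr ?_ rfl rfl
        rw [Multiset.map_cons, Multiset.sum_cons, oscLevel]
        push_cast
        omega
      · rw [if_neg hy, if_neg hy, mul_zero, ite_self]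
    have h2 : coeff t ((F (annihilation B b α x (monomial s (Polynomial.X ^ i)))).coeff j)
        = if (wt t : ℤ) = wt s + ((x ::ₘ m).map oscLevel).sum + j + i then
          coeff t (G (constDerivation (annihilationCoeff B b x) (monomial s 1)
            + zeroModeCoeff B b α x • monomial s 1)) else 0 := by
      let Φ : HeisZ d →ₗ[ℂ] ℂ :=
        { toFun := fun p => coeff t ((F p).coeff j)
          map_add' := fun p q => by simp
          map_smul' := fun c p => by simp }
      have hΦ : ∀ (s' : Fin d × ℕ →₀ ℕ) (i' : ℕ), Φ (monomial s' (Polynomial.X ^ i'))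
        = if (wt t : ℤ) = wt s' + (m.map oscLevel).sum + j + i' then
          coeff t (G (monomial s' 1)) else 0 := fun s' i' => ih s' t i' j ht
      change Φ _ = _
      rw [annihilation_monomial, constDerivation_monomial_eq_sum]
      simp only [map_add, map_sum, map_smul, coeff_add, coeff_sum, coeff_smul, hΦ]
      rw [Multiset.map_cons, Multiset.sum_cons, oscLevel, ite_add_zero]
      congr 1
      · rw [← sum_ite_zero_const]
        refine sum_congr rfl fun y hy => ?_
        have hw := wt_sub_single hy
        rw [smul_ite, smul_zero]
        refine if_congr ?_ rfl rfl
        push_cast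
        omega
      · rw [smul_ite, smul_zero]
        refine if_congr ?_ rfl rfl
        push_cast
        omega
    rw [h1, h2, ite_add_zero]

end SectorField

/-! ### Square-bracket modes -/

section SquareModes

open MvPolynomial Finset

variable {d : ℕ} {Λ : Type*} [AddCommGroup Λ]

theorem Y_single_monomial (B : LinearMap.BilinForm ℤ Λ) (b : Module.Basis (Fin d) ℤ Λ) (α : Λ)
    (s : Fin d × ℕ →₀ ℕ) (c : ℂ) (p : Heis d) :
    Y B b (Finsupp.single 0 (monomial s c)) (Finsupp.single α p)
      = inclSector d α (c • monomialField B b 0 α s p) := by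
  have h : monomial s c = c • basisMonomials (Fin d × ℕ) ℂ s := by
    simp [smul_monomial]
  rw [h, ← Finsupp.smul_single, map_smul, LinearMap.smul_apply, Y, Finsupp.lsum_single,
    Module.Basis.constr_basis, Finsupp.lsum_single, LinearMap.comp_apply, add_zero, map_smul]

theorem constZ_monomial (s : Fin d × ℕ →₀ ℕ) (c : ℂ) :
    constZ d (monomial s c) = c • monomial s (Polynomial.X ^ 0) := by
  rw [smul_monomial, pow_zero, Polynomial.smul_eq_C_mul, mul_one]
  exact map_monomial _ _ _

theorem toLaurent_constZ (f : Heis d) : toLaurent d (constZ d f) = HahnSeries.C f := by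
  induction f using MvPolynomial.induction_on' with
  | monomial s c =>
    rw [constZ_monomial, toLaurent_smul, ← Polynomial.monomial_one_right_eq_X_pow,
      toLaurent_monomial]
    ext n : 2
    rw [HahnSeries.coeff_smul, HahnSeries.C_apply, HahnSeries.coeff_single, HahnSeries.coeff_single]
    split_ifs <;> simp_all [smul_monomial]
  | add p q hp hq => rw [map_add, map_add, hp, hq, map_add]

/-- On the vacuum sector the zero mode vanishes, and the annihilation modes of `(b i)(z)`
are constant-coefficient derivations. -/
theorem coeff_toLaurent_annihilation (B : LinearMap.BilinForm ℤ Λ) (b : Module.Basis (Fin d) ℤ Λ)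
    (i : Fin d) (f : Heis d) (k : ℤ) :
    (toLaurent d (annihilation B b 0 (i, 0) (constZ d f))).coeff k
      = constDerivation
          (fun y => if k = -(y.2 + 2) then annihilationCoeff B b (i, 0) y else 0) f := by
  induction f using MvPolynomial.induction_on' with
  | monomial s c =>
    have hc : monomial s c = c • monomial s (1 : ℂ) := by simp [smul_monomial]
    have hz : zeroModeCoeff B b 0 (i, 0) = 0 := by simp [zeroModeCoeff]
    rw [constZ_monomial, LinearMap.map_smul_of_tower, toLaurent_smul, HahnSeries.coeff_smul, hc,
      Derivation.map_smul, annihilation_monomial, hz, zero_smul, add_zero,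
      constDerivation_monomial_eq_sum, map_sum, HahnSeries.coeff_sum]
    congr 1
    refine sum_congr rfl fun y _ => ?_
    rw [toLaurent_smul, HahnSeries.coeff_smul, ← Polynomial.monomial_one_right_eq_X_pow,
      toLaurent_monomial, HahnSeries.coeff_single]
    push_cast
    simp only [zero_add, add_zero]
    split_ifs <;> simp
  | add p q hp hq => simp only [map_add, HahnSeries.coeff_add, hp, hq]

/-- The coefficients of `log (1 + w)^(-r) = w^(-r) (w / log (1 + w))^r`. -/
theorem coeff_logOneAdd_zpow_neg (r : ℕ) (k : ℤ) :
    (logOneAdd ^ (-(r : ℤ))).coeff k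
      = if k + r < 0 then 0 else PowerSeries.coeff (k + r).natAbs (invLogQuot ^ r) := by
  have h1 : logOneAdd = HahnSeries.ofPowerSeries ℤ ℂ (PowerSeries.X * logQuot) := by
    rw [logOneAdd]
    congr 1
    ext n
    cases n with
    | zero => simp
    | succ n =>
      rw [PowerSeries.coeff_succ_X_mul, logQuot, PowerSeries.coeff_mk, PowerSeries.coeff_mk]
      push_cast
      ring
  have h2 : logOneAdd ^ (-(r : ℤ))
      = HahnSeries.single (-(r : ℤ)) (1 : ℂ) * HahnSeries.ofPowerSeries ℤ ℂ (invLogQuot ^ r) := by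
    rw [zpow_neg, zpow_natCast, inv_eq_iff_eq_inv]
    apply eq_inv_of_mul_eq_one_left
    have h3 : (PowerSeries.X * logQuot) ^ r * invLogQuot ^ r = PowerSeries.X ^ r := by
      rw [mul_pow, mul_assoc, ← mul_pow, mul_comm logQuot, invLogQuot_mul_logQuot, one_pow, mul_one]
    rw [h1, ← map_pow, mul_left_comm, ← map_mul, h3, HahnSeries.ofPowerSeries_X_pow,
      HahnSeries.single_mul_single]
    simp
  rw [h2, HahnSeries.coeff_single_mul, one_mul, sub_neg_eq_add, PowerSeries.coeff_coe]

/-- The `ℂ`-linear extension `⟨a, b j⟩` of the form, where `A` lists the coordinates of `a`. -/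
def pairing (B : LinearMap.BilinForm ℤ Λ) (b : Module.Basis (Fin d) ℤ Λ) (A : Fin d → ℂ)
    (j : Fin d) : ℂ := ∑ i, A i * B (b i) (b j)

/-- The creation part of `a[-r]` on the vacuum sector, a linear form in the `a(-n-1)`. -/
def squareCreation (A : Fin d → ℂ) (r : ℕ) : Heis d :=
  ∑ n ∈ range r, PowerSeries.coeff (r - 1 - n) (invLogQuot ^ r) • ∑ i, A i • X (i, n)

/-- The values on the variables of the annihilation part of `a[-r]` on the vacuum sector. -/
def squareAnnihilation (B : LinearMap.BilinForm ℤ Λ) (b : Module.Basis (Fin d) ℤ Λ)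
    (A : Fin d → ℂ) (r : ℕ) (y : Fin d × ℕ) : ℂ :=
  PowerSeries.coeff (y.2 + 1 + r) (invLogQuot ^ r) * ((y.2 + 1) * pairing B b A y.1)

theorem squareMode_add (B : LinearMap.BilinForm ℤ Λ) (b : Module.Basis (Fin d) ℤ Λ)
    (a : TensorProduct ℤ ℂ Λ) (n : ℤ) (u v : V d Λ) :
    squareMode B b a n (u + v) = squareMode B b a n u + squareMode B b a n v := by
  simp only [squareMode, map_add, smul_add]
  rfl

/-- The residue of `ℓ(z) y(z)` for `y` in one sector, over any range of exponents containing all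
contributions. -/
theorem coeff_smul_inclSector {Γ : Type*} (ℓ : LaurentSeries ℂ) (γ : Γ)
    (z : LaurentSeries (Heis d))
    (J : Finset ℤ)
    (hJ : ∀ k ∉ J, ℓ.coeff k • z.coeff (-1 - k) = 0) :
    ((HahnModule.of ℂ).symm (ℓ • inclSector d γ z)).coeff (-1)
      = Finsupp.single γ (∑ k ∈ J, ℓ.coeff k • z.coeff (-1 - k)) := by
  have hc : ∀ k : ℤ, ((HahnModule.of ℂ).symm (inclSector d γ z)).coeff k
      = Finsupp.single γ (z.coeff k) := fun k => by simp [inclSector]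
  have := map_coeff_hahn_smul (AddMonoidHom.id (V d Γ)) ℓ (inclSector d γ z) (-1) J ?_
  · simp only [AddMonoidHom.id_apply, hc, Finsupp.smul_single] at this
    rw [this, Finsupp.single_finsetSum]
  · intro k hk
    rw [AddMonoidHom.id_apply, hc, Finsupp.smul_single, hJ k hk, Finsupp.single_zero]

theorem monomialField_single (B : LinearMap.BilinForm ℤ Λ) (b : Module.Basis (Fin d) ℤ Λ)
    (x : Fin d × ℕ) (f : Heis d) :
    monomialField B b 0 0 (Finsupp.single x 1) f
      = creation x * HahnSeries.C f + toLaurent d (annihilation B b 0 x (constZ d f)) := by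
  rw [monomialField, Finsupp.toMultiset_single, one_smul, LinearMap.comp_apply,
    ← Multiset.cons_zero, Multiset.foldr_cons, Multiset.foldr_zero, ← toLaurent_constZ,
    ← expField_zero_apply B b 0, ← expField_zero_apply B b 0]
  rfl

/-- The creation half of `Y(a(-1)𝟏, z) f` for `f` in the vacuum sector. -/
def cartanCreation (A : Fin d → ℂ) (f : Heis d) : LaurentSeries (Heis d) :=
  ∑ i, A i • (creation (i, 0) * HahnSeries.C f)

/-- The annihilation half of `Y(a(-1)𝟏, z) f` for `f` in the vacuum sector. -/
def cartanAnnihilation (B : LinearMap.BilinForm ℤ Λ) (b : Module.Basis (Fin d) ℤ Λ)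
    (A : Fin d → ℂ) (f : Heis d) : LaurentSeries (Heis d) :=
  ∑ i, A i • toLaurent d (annihilation B b 0 (i, 0) (constZ d f))

theorem Y_cartanState_single (B : LinearMap.BilinForm ℤ Λ) (b : Module.Basis (Fin d) ℤ Λ)
    (a : TensorProduct ℤ ℂ Λ) (f : Heis d) :
    Y B b (cartanState b a) (Finsupp.single 0 f)
      = inclSector d (0 : Λ) (cartanCreation ((b.baseChange ℂ).repr a) f)
        + inclSector d (0 : Λ) (cartanAnnihilation B b ((b.baseChange ℂ).repr a) f) := by
  have h : ∀ i : Fin d, Y B b (Finsupp.single 0 (X (i, 0) : Heis d)) (Finsupp.single 0 f)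
      = inclSector d (0 : Λ) (creation (i, 0) * HahnSeries.C f
        + toLaurent d (annihilation B b 0 (i, 0) (constZ d f))) := by
    intro i
    rw [X, Y_single_monomial, one_smul, monomialField_single]
  rw [cartanState, ← Finsupp.lsingle_apply (R := ℂ), map_sum, map_sum, LinearMap.sum_apply,
    cartanCreation, cartanAnnihilation, ← map_add, ← sum_add_distrib, map_sum]
  refine sum_congr rfl fun i _ => ?_
  rw [map_smul, map_smul, LinearMap.smul_apply, Finsupp.lsingle_apply, h, ← smul_add, ← map_smul]

theorem coeff_cartanCreation (A : Fin d → ℂ) (f : Heis d) (k : ℤ) :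
    (cartanCreation A f).coeff k
      = (if k < 0 then 0 else ∑ i, A i • X (i, k.natAbs)) * f := by
  rw [cartanCreation, HahnSeries.coeff_sum]
  simp only [HahnSeries.coeff_smul, HahnSeries.C_apply, HahnSeries.coeff_mul_single_zero,
    creation, PowerSeries.coeff_coe]
  split_ifs <;> simp [sum_mul]

theorem coeff_cartanAnnihilation (B : LinearMap.BilinForm ℤ Λ) (b : Module.Basis (Fin d) ℤ Λ)
    (A : Fin d → ℂ) (s : Fin d × ℕ →₀ ℕ) (c : ℂ) (k : ℤ) :
    (cartanAnnihilation B b A (monomial s c)).coeff k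
      = c • ∑ y ∈ s.support, if k = -(y.2 + 2) then
        ((y.2 + 1 : ℂ) * pairing B b A y.1 * s y) • monomial (s - Finsupp.single y 1) (1 : ℂ)
          else 0 := by
  have hfc : monomial s c = c • monomial s (1 : ℂ) := by simp [smul_monomial]
  rw [cartanAnnihilation, HahnSeries.coeff_sum]
  simp only [HahnSeries.coeff_smul, coeff_toLaurent_annihilation, hfc, Derivation.map_smul,
    constDerivation_monomial_eq_sum]
  simp only [smul_comm _ c]
  rw [← smul_sum]
  congr 1
  simp only [smul_sum]
  rw [sum_comm]
  refine sum_congr rfl fun y _ => ?_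
  split_ifs with h
  · simp only [smul_smul, ← sum_smul]
    congr 1
    rw [pairing, mul_sum, sum_mul]
    refine sum_congr rfl fun i _ => ?_
    simp only [annihilationCoeff]
    simp
    ring
  · simp

/-- The action of `a[-r]` on the vacuum sector: a creation operator plus a derivation. -/
theorem squareMode_neg_single (B : LinearMap.BilinForm ℤ Λ) (b : Module.Basis (Fin d) ℤ Λ)
    (a : TensorProduct ℤ ℂ Λ) (r : ℕ) (f : Heis d) :
    squareMode B b a (-(r : ℤ)) (Finsupp.single 0 f)
      = Finsupp.single 0 (squareCreation ((b.baseChange ℂ).repr a) r * f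
          + constDerivation (squareAnnihilation B b ((b.baseChange ℂ).repr a) r) f) := by
  set A : Fin d → ℂ := ⇑((b.baseChange ℂ).repr a) with hA
  induction f using MvPolynomial.induction_on' with
  | add p q hp hq =>
    rw [Finsupp.single_add, squareMode_add, hp, hq, ← Finsupp.single_add, mul_add, map_add]
    congr 1
    ring
  | monomial s c =>
    set f : Heis d := monomial s c with hf
    have hc₁ := coeff_cartanCreation A f
    have hc₂ := coeff_cartanAnnihilation B b A s c
    rw [← hf] at hc₂
    set z₁ := cartanCreation A f with hz₁
    set z₂ := cartanAnnihilation B b A f with hz₂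
    set ℓ := logOneAdd ^ (-(r : ℤ)) with hℓ
    rw [squareMode, Y_cartanState_single, smul_add]
    change ((HahnModule.of ℂ).symm (ℓ • inclSector d (0 : Λ) z₁)).coeff (-1)
      + ((HahnModule.of ℂ).symm (ℓ • inclSector d (0 : Λ) z₂)).coeff (-1) = _
    have hinj : Function.Injective fun n : ℕ => -1 - (n : ℤ) := fun n m h => by simpa using h
    rw [coeff_smul_inclSector ℓ (0 : Λ) z₁ ((range r).map ⟨_, hinj⟩),
      coeff_smul_inclSector ℓ (0 : Λ) z₂ (Icc 0 (wt s : ℤ)), ← Finsupp.single_add]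
    · congr 2
      · rw [sum_map, squareCreation, sum_mul]
        refine sum_congr rfl fun n hn => ?_
        have hn' := mem_range.1 hn
        have h1 : -1 - (-1 - (n : ℤ)) = n := by ring
        have h2 : -1 - (n : ℤ) + r = ((r - 1 - n : ℕ) : ℤ) := by omega
        simp only [Function.Embedding.coeFn_mk]
        rw [hc₁, hℓ, coeff_logOneAdd_zpow_neg, h1, h2, if_neg (by omega), if_neg (by omega),
          Int.natAbs_natCast, Int.natAbs_natCast, smul_mul_assoc]
      · have hfc : f = c • monomial s (1 : ℂ) := by rw [hf]; simp [smul_monomial]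
        simp only [hc₂]
        rw [hfc, Derivation.map_smul, constDerivation_monomial_eq_sum]
        simp only [smul_comm _ c]
        rw [← smul_sum]
        congr 1
        simp only [smul_sum]
        rw [sum_comm]
        refine sum_congr rfl fun y hy => ?_
        have hy' := wt_sub_single hy
        rw [sum_eq_single_of_mem ((y.2 + 1 : ℕ) : ℤ)]
        · have h2 : ((y.2 + 1 : ℕ) : ℤ) + r = ((y.2 + 1 + r : ℕ) : ℤ) := by push_cast; ring
          rw [if_pos (by push_cast; ring), hℓ, coeff_logOneAdd_zpow_neg, h2, if_neg (by omega),
            Int.natAbs_natCast, smul_smul, squareAnnihilation]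
          congr 1
          ring
        · rw [mem_Icc]
          omega
        · intro k _ hk
          rw [if_neg (by push_cast at hk; omega), smul_zero]
    · intro k hk
      rw [hc₂, sum_eq_zero, smul_zero, smul_zero]
      intro y hy
      have hy' := wt_sub_single hy
      rw [mem_Icc] at hk
      exact if_neg (by omega)
    · intro k hk
      rw [hc₁, hℓ, coeff_logOneAdd_zpow_neg]
      by_cases h1 : k + r < 0
      · rw [if_pos h1, zero_smul]
      · by_cases h2 : -1 - k < 0
        · rw [if_pos h2, zero_mul, smul_zero]
        · refine absurd (mem_map.2 ⟨(-1 - k).toNat, ?_, ?_⟩) hk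
          · rw [mem_range]
            omega
          · simp only [Function.Embedding.coeFn_mk]
            omega

end SquareModes

/-! ### Traces of square-bracket states on a sector -/

section SectorTrace

open MvPolynomial Finset

variable {d : ℕ} {Λ : Type*} [AddCommGroup Λ]

/-- The differential equation of `(1 + w)^(m-1)`, from the recursion of its coefficients. -/
theorem one_add_X_mul_derivative_mk {m : ℂ} {e : ℕ → ℂ}
    (h : ∀ n : ℕ, (n + 1) * e (n + 1) = (m - 1 - n) * e n) :
    (1 + PowerSeries.X) * PowerSeries.derivative ℂ (PowerSeries.mk e)
      = (m - 1) • PowerSeries.mk e := by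
  ext n
  rw [add_mul, one_mul, map_add, PowerSeries.coeff_derivative, PowerSeries.coeff_smul,
    PowerSeries.coeff_mk, PowerSeries.coeff_mk, smul_eq_mul]
  cases n with
  | zero =>
    have := h 0
    rw [PowerSeries.coeff_zero_X_mul]
    push_cast at this ⊢
    linear_combination this
  | succ n =>
    have := h (n + 1)
    rw [PowerSeries.coeff_succ_X_mul, PowerSeries.coeff_derivative, PowerSeries.coeff_mk]
    push_cast at this ⊢
    linear_combination this

/-- `∑ₙ cₙ e(n) = m^R / R!`, where `cₙ` is the coefficient of `a(-n-1)` in `a[-R-1]` and `e` is the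
sequence of coefficients of `(1 + w)^(m-1)`. -/
theorem sum_coeff_invLogQuot_pow_mul {m : ℂ} {e : ℕ → ℂ} (he0 : e 0 = 1)
    (h : ∀ n : ℕ, (n + 1) * e (n + 1) = (m - 1 - n) * e n) (R : ℕ) :
    ∑ n ∈ range (R + 1), PowerSeries.coeff (R - n) (invLogQuot ^ (R + 1)) * e n
      = m ^ R / R.factorial := by
  rw [← coeff_invLogQuot_pow_mul (by simpa using he0) (one_add_X_mul_derivative_mk h) R, mul_comm,
    PowerSeries.coeff_mul, Nat.sum_antidiagonal_eq_sum_range_succ_mk]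
  refine sum_congr rfl fun n _ => ?_
  rw [PowerSeries.coeff_mk, mul_comm]

/-- The coefficient of the variable `x` in the creation part of `a[-r]`. -/
def squareCreationCoeff (A : Fin d → ℂ) (r : ℕ) (x : Fin d × ℕ) : ℂ :=
  PowerSeries.coeff (r - 1 - x.2) (invLogQuot ^ r) * A x.1

theorem squareCreation_eq_sum (A : Fin d → ℂ) (r : ℕ) :
    squareCreation A r = ∑ x ∈ modeVars d r, squareCreationCoeff A r x • X x := by
  rw [squareCreation, modeVars, sum_product_right]
  refine sum_congr rfl fun n _ => ?_
  rw [smul_sum]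
  refine sum_congr rfl fun i _ => ?_
  rw [smul_smul, squareCreationCoeff]

theorem sum_squareCreationCoeff_mul {m : ℂ} {e : ℕ → ℂ} (he0 : e 0 = 1)
    (h : ∀ n : ℕ, (n + 1) * e (n + 1) = (m - 1 - n) * e n) (A : Fin d → ℂ) (R : ℕ)
    (g : Fin d → ℂ) :
    ∑ x ∈ modeVars d (R + 1), squareCreationCoeff A (R + 1) x * (e x.2 * g x.1)
      = (∑ i, A i * g i) * (m ^ R / R.factorial) := by
  rw [← sum_coeff_invLogQuot_pow_mul he0 h, sum_mul_sum, modeVars, sum_product]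
  refine sum_congr rfl fun i _ => sum_congr rfl fun n _ => ?_
  rw [squareCreationCoeff, Nat.add_sub_cancel]
  ring

/-- The coefficient in `a[-R-1]` of a creation operator of level `m`: here `e` is the sequence of
coefficients of `(1 + w)^(m-1)`. -/
theorem sum_squareCreationCoeff_mul_creationCoeff (A : Fin d → ℂ) (R : ℕ) (y : Fin d × ℕ) :
    ∑ x ∈ modeVars d (R + 1), squareCreationCoeff A (R + 1) x * creationCoeff x y
      = A y.1 * ((y.2 + 1 : ℂ) ^ R / R.factorial) := by
  have h := sum_squareCreationCoeff_mul (m := y.2 + 1) (e := fun n => (y.2.choose n : ℂ))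
    (by simp) ?_ A R (fun i => if y.1 = i then 1 else 0)
  · simp only [mul_ite, mul_one, mul_zero, sum_ite_eq, mem_univ, if_true] at h
    simpa [creationCoeff] using h
  · intro n
    have h := Nat.choose_succ_right_eq y.2 n
    rcases le_or_gt n y.2 with hn | hn
    · have h' : ((y.2.choose (n + 1) : ℕ) : ℂ) * (n + 1 : ℕ)
          = y.2.choose n * ((y.2 - n : ℕ) : ℂ) := by
        exact_mod_cast h
      rw [Nat.cast_sub hn] at h'
      push_cast at h'
      linear_combination h'
    · simp [Nat.choose_eq_zero_of_lt hn, Nat.choose_eq_zero_of_lt (hn.trans n.lt_succ_self)]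

/-- The coefficient in `a[-R-1]` of an annihilation operator of level `m`: here `e` is the sequence
of coefficients of `(1 + w)^(-m-1)`. -/
theorem sum_squareCreationCoeff_mul_annihilationCoeff (B : LinearMap.BilinForm ℤ Λ)
    (b : Module.Basis (Fin d) ℤ Λ) (A : Fin d → ℂ) (R : ℕ) (y : Fin d × ℕ) :
    ∑ x ∈ modeVars d (R + 1), squareCreationCoeff A (R + 1) x * annihilationCoeff B b x y
      = (y.2 + 1) * pairing B b A y.1 * ((-(y.2 + 1 : ℂ)) ^ R / R.factorial) := by
  have h := sum_squareCreationCoeff_mul (m := -(y.2 + 1))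
    (e := fun n => (-1) ^ n * ((y.2 + 1 + n).choose n : ℂ))
    (by simp) ?_ A R (fun i => (y.2 + 1) * B (b i) (b y.1))
  · have h1 : ∀ x, squareCreationCoeff A (R + 1) x * annihilationCoeff B b x y
        = squareCreationCoeff A (R + 1) x * ((-1) ^ x.2 * ((y.2 + 1 + x.2).choose x.2 : ℂ)
          * ((y.2 + 1) * B (b x.1) (b y.1))) := by
      intro x
      rw [annihilationCoeff]
      ring
    simp only [h1]
    rw [h, pairing, mul_sum]
    congr 1
    refine sum_congr rfl fun i _ => ?_
    ring
  · intro n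
    have h : (n + 1) * (y.2 + 1 + (n + 1)).choose (n + 1)
        = (y.2 + 1 + n + 1) * (y.2 + 1 + n).choose n := by
      rw [Nat.add_one_mul_choose_eq, mul_comm]
      rfl
    have h' : ((n : ℂ) + 1) * ((y.2 + 1 + (n + 1)).choose (n + 1) : ℕ)
        = (y.2 + 1 + n + 1) * ((y.2 + 1 + n).choose n : ℕ) := by
      exact_mod_cast h
    rw [pow_succ]
    linear_combination -(-1) ^ n * h'

/-- The coefficient in `a[-R-1]` of the zero mode: here `e` is the sequence of coefficients of
`(1 + w)^(-1)`, and the sum vanishes unless `R = 0`. -/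
theorem sum_squareCreationCoeff_mul_zeroModeCoeff (B : LinearMap.BilinForm ℤ Λ)
    (b : Module.Basis (Fin d) ℤ Λ) (A : Fin d → ℂ) (α : Λ) (R : ℕ) :
    ∑ x ∈ modeVars d (R + 1), squareCreationCoeff A (R + 1) x * zeroModeCoeff B b α x
      = (∑ i, A i * B (b i) α) * ((0 : ℂ) ^ R / R.factorial) := by
  refine sum_squareCreationCoeff_mul (m := 0) (e := fun n => (-1) ^ n) (by simp) ?_ A R
    (fun i => (B (b i) α : ℂ))
  intro n
  rw [pow_succ]
  ring

/-- The action of `a[-r]` on the vacuum sector `S`. -/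
def squareOp (B : LinearMap.BilinForm ℤ Λ) (b : Module.Basis (Fin d) ℤ Λ) (A : Fin d → ℂ) (r : ℕ)
    (f : Heis d) : Heis d :=
  squareCreation A r * f + constDerivation (squareAnnihilation B b A r) f

/-- The state `a[-1]^s 𝟏`, as an element of `S`. -/
def squareState (B : LinearMap.BilinForm ℤ Λ) (b : Module.Basis (Fin d) ℤ Λ) (A : Fin d → ℂ)
    (s : ℕ) : Heis d := (squareOp B b A 1)^[s] 1

variable (B : LinearMap.BilinForm ℤ Λ) (b : Module.Basis (Fin d) ℤ Λ) (A : Fin d → ℂ)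

theorem squareState_zero : squareState B b A 0 = 1 := rfl

theorem squareState_succ (s : ℕ) :
    squareState B b A (s + 1) = squareOp B b A 1 (squareState B b A s) :=
  Function.iterate_succ_apply' _ _ _

/-- Constant-coefficient derivations commute with `a[-1]` up to a scalar. -/
theorem constDerivation_squareState (c : Fin d × ℕ → ℂ) (s : ℕ) :
    constDerivation c (squareState B b A s)
      = (s * ∑ i, A i * c (i, 0)) • squareState B b A (s - 1) := by
  have hc : constDerivation c (squareCreation A 1) = C (∑ i, A i * c (i, 0)) := by
    rw [squareCreation, sum_range_one]
    simp [constantCoeff_invLogQuot, smul_eq_C_mul]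
  induction s with
  | zero => simp [squareState_zero]
  | succ s ih =>
    rw [squareState_succ, squareOp, map_add, Derivation.leibniz, constDerivation_comm, ih, hc,
      Derivation.map_smul, smul_eq_mul, smul_eq_mul, Nat.add_sub_cancel]
    cases s with
    | zero => simp [squareState_zero, smul_eq_C_mul]
    | succ s =>
      rw [Nat.add_sub_cancel, squareState_succ, squareOp, smul_eq_C_mul, smul_eq_C_mul,
        smul_eq_C_mul]
      push_cast
      simp only [map_mul, map_add, map_one, map_natCast]
      ring

/-- The graded trace of the field of `f ∈ S` on the sector `S ⊗ e^α`, truncated to the oscillators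
of level at most `M`. -/
def sectorTrace (α : Λ) (M : ℕ) : Heis d →ₗ[ℂ] PowerSeries ℂ :=
  gradedTrace (modeVars d M) oscLevel ∘ₗ
    wickField (modeVars d M) creationCoeff (annihilationCoeff B b) (zeroModeCoeff B b α)

/-- The Eisenstein series `G_k`, with the Lambert series truncated after `M` terms. -/
def truncEisenstein (M k : ℕ) : PowerSeries ℂ :=
  PowerSeries.C (-((bernoulli k : ℚ) : ℂ) / (2 * k))
    + ∑ l ∈ range M, ((l + 1 : ℂ) ^ (k - 1)) • lambertTerm (l + 1)

theorem sectorTrace_linearForm_mul (α : Λ) (M : ℕ) (J : Finset (Fin d × ℕ))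
    (g : Fin d × ℕ → ℂ) (f : Heis d) :
    sectorTrace B b α M ((∑ x ∈ J, g x • X x) * f)
      = (∑ x ∈ J, g x * zeroModeCoeff B b α x) • sectorTrace B b α M f
        + ∑ y ∈ modeVars d M, lambertTerm (oscLevel y) *
          ((∑ x ∈ J, g x * creationCoeff x y) •
              sectorTrace B b α M (constDerivation (fun z => annihilationCoeff B b z y) f)
          + (∑ x ∈ J, g x * annihilationCoeff B b x y) •
              sectorTrace B b α M (constDerivation (fun z => creationCoeff z y) f)) := by
  have h : ∀ x, sectorTrace B b α M (X x * f) = _ :=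
    fun x => gradedTrace_wickField_X_mul oscLevel_pos x f
  rw [sum_mul, map_sum]
  simp only [smul_mul_assoc, map_smul, h, smul_add, sum_add_distrib, smul_sum, sum_smul, smul_smul]
  congr 1
  rw [sum_comm]
  refine sum_congr rfl fun y _ => ?_
  rw [← sum_add_distrib, mul_sum]
  refine sum_congr rfl fun x _ => ?_
  rw [← mul_smul_comm, smul_add, smul_smul, smul_smul]
  rfl

/-- The trace of `a[-R-1] a[-1]^s 𝟏` on a sector, for even `R`. For odd `R` the two contributions
`m^R` and `(-m)^R` of the creation and annihilation operators cancel. -/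
theorem sectorTrace_squareOp (hA : ∑ i, A i * pairing B b A i = 1) (α : Λ) (M : ℕ) {R : ℕ}
    (hR : Even R) (s : ℕ) :
    sectorTrace B b α M (squareOp B b A (R + 1) (squareState B b A s))
      = ((∑ i, A i * B (b i) α) * ((0 : ℂ) ^ R / R.factorial)) •
          sectorTrace B b α M (squareState B b A s)
        + (2 * s / R.factorial : ℂ) •
          (truncEisenstein M (R + 2) * sectorTrace B b α M (squareState B b A (s - 1))) := by
  rw [squareOp, map_add, squareCreation_eq_sum, sectorTrace_linearForm_mul,
    sum_squareCreationCoeff_mul_zeroModeCoeff, add_assoc]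
  congr 1
  simp only [sum_squareCreationCoeff_mul_creationCoeff,
    sum_squareCreationCoeff_mul_annihilationCoeff, constDerivation_squareState, map_smul]
  set T := sectorTrace B b α M (squareState B b A (s - 1)) with hT
  have hf : (R.factorial : ℂ) ≠ 0 := by exact_mod_cast R.factorial_ne_zero
  -- the constant term of the Eisenstein series comes from the derivation part of `a[-R-1]`
  have h1 : ∑ i, A i * squareAnnihilation B b A (R + 1) (i, 0)
      = 2 / R.factorial * (-((bernoulli (R + 2) : ℚ) : ℂ) / (2 * (R + 2 : ℕ))) := by
    have : ∀ i, A i * squareAnnihilation B b A (R + 1) (i, 0)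
        = PowerSeries.coeff (R + 1 + 1) (invLogQuot ^ (R + 1)) * (A i * pairing B b A i) := by
      intro i
      rw [squareAnnihilation]
      simp only [Nat.cast_zero, zero_add, one_mul, add_comm 1 (R + 1)]
      ring
    simp only [this]
    rw [← mul_sum, hA, coeff_succ_invLogQuot_pow, mul_one, Nat.factorial_succ, Nat.factorial_succ]
    have h2 : (R + 1 + 1 : ℂ) ≠ 0 := by exact_mod_cast (R + 1).succ_ne_zero
    have h3 : (R + 1 : ℂ) ≠ 0 := by exact_mod_cast R.succ_ne_zero
    have h4 : (R + 2 : ℂ) ≠ 0 := by exact_mod_cast (R + 1).succ_ne_zero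
    push_cast
    field_simp
    ring
  -- its Lambert series comes from the commutators with the oscillators
  have h2 : ∑ y ∈ modeVars d M, lambertTerm (oscLevel y) *
      ((A y.1 * ((y.2 + 1 : ℂ) ^ R / R.factorial)) •
          (s * ∑ i, A i * annihilationCoeff B b (i, 0) y) • T
        + ((y.2 + 1) * pairing B b A y.1 * ((-(y.2 + 1 : ℂ)) ^ R / R.factorial)) •
          (s * ∑ i, A i * creationCoeff (i, 0) y) • T)
      = (2 * s / R.factorial : ℂ) •
        ((∑ l ∈ range M, ((l + 1 : ℂ) ^ (R + 1)) • lambertTerm (l + 1)) * T) := by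
    rw [modeVars, sum_product_right, sum_mul, smul_sum]
    refine sum_congr rfl fun l _ => ?_
    have h3 : ∀ i, (A i * pairing B b A i) • ((2 * s / R.factorial : ℂ) •
        ((l + 1 : ℂ) ^ (R + 1) • lambertTerm (l + 1) * T))
        = lambertTerm (oscLevel (i, l)) *
      ((A i * ((l + 1 : ℂ) ^ R / R.factorial)) •
          (s * ∑ j, A j * annihilationCoeff B b (j, 0) (i, l)) • T
        + ((l + 1) * pairing B b A i * ((-(l + 1 : ℂ)) ^ R / R.factorial)) •
          (s * ∑ j, A j * creationCoeff (j, 0) (i, l)) • T) := by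
      intro i
      have h4 : ∑ j, A j * annihilationCoeff B b (j, 0) (i, l) = (l + 1) * pairing B b A i := by
        rw [pairing, mul_sum]
        refine sum_congr rfl fun j _ => ?_
        simp [annihilationCoeff]
        ring
      have h5 : ∑ j, A j * creationCoeff (j, 0) (i, l) = A i := by
        simp [creationCoeff]
      rw [h4, h5, hR.neg_pow]
      simp only [smul_smul]
      rw [← add_smul, mul_smul_comm, smul_mul_assoc, smul_smul]
      congr 1
      ring
    rw [← sum_congr rfl fun i _ => h3 i, ← sum_smul, hA, one_smul]
  rw [h2, h1, truncEisenstein, add_mul, smul_add, add_comm, ← PowerSeries.smul_eq_C_mul, smul_smul]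
  congr 2
  push_cast
  ring

/-- The solution of the recursion of Gaussian moments with mean `c` and variance `2 g`. The number
`N` of terms is only bounded below, as all terms with `2 k > s` vanish. -/
theorem gaussian_recursion {P : Type*} [CommRing P] [Algebra ℂ P] (c : ℂ) (g : P) (h : ℕ → P)
    (hrec : ∀ s, h (s + 1) = c • h s + (2 * s : ℂ) • (g * h (s - 1))) (s N : ℕ) (hN : s < 2 * N) :
    h s = ∑ k ∈ range N,
      ((s.choose (2 * k) : ℂ) * (2 * k).factorial / k.factorial * c ^ (s - 2 * k)) •
        (g ^ k * h 0) := by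
  induction s using Nat.strong_induction_on generalizing N with
  | _ s ih =>
    obtain ⟨N, rfl⟩ : ∃ N', N = N' + 1 := ⟨N - 1, by omega⟩
    cases s with
    | zero =>
      rw [sum_range_succ', sum_eq_zero, zero_add]
      · simp
      · intro k _
        simp [Nat.choose_eq_zero_of_lt]
    | succ s =>
      rw [hrec, ih s (by omega) (N + 1) (by omega), sum_range_succ', sum_range_succ', smul_add,
        smul_sum, add_right_comm]
      congr 1
      · have h2 : (2 * s : ℂ) • (g * h (s - 1)) = ∑ k ∈ range N,
            (2 * s * (((s - 1).choose (2 * k) : ℂ) * (2 * k).factorial / k.factorial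
              * c ^ (s - 1 - 2 * k))) • (g ^ (k + 1) * h 0) := by
          cases s with
          | zero => simp
          | succ s =>
            rw [Nat.add_sub_cancel, ih s (by omega) N (by omega), mul_sum, smul_sum]
            refine sum_congr rfl fun k _ => ?_
            rw [mul_smul_comm, smul_smul, pow_succ', mul_assoc g]
        rw [h2, ← sum_add_distrib]
        refine sum_congr rfl fun k _ => ?_
        rw [smul_smul, ← add_smul]
        congr 1
        have hk : (k.factorial : ℂ) ≠ 0 := by exact_mod_cast k.factorial_ne_zero
        have hk1 : (k + 1 : ℂ) ≠ 0 := by exact_mod_cast k.succ_ne_zero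
        have e1 : s + 1 - 2 * (k + 1) = s - 1 - 2 * k := by omega
        have e2 : c * ((s.choose (2 * (k + 1)) : ℂ) * c ^ (s - 2 * (k + 1)))
            = s.choose (2 * (k + 1)) * c ^ (s - 1 - 2 * k) := by
          rcases le_or_gt (2 * (k + 1)) s with hks | hks
          · rw [show s - 1 - 2 * k = s - 2 * (k + 1) + 1 by omega, pow_succ]
            ring
          · simp [Nat.choose_eq_zero_of_lt hks]
        have e3 : ((s + 1).choose (2 * (k + 1)) : ℂ)
            = s.choose (2 * k + 1) + s.choose (2 * (k + 1)) := by
          rw [show 2 * (k + 1) = (2 * k + 1) + 1 by ring, Nat.choose_succ_succ, Nat.cast_add]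
        have e4 : (s : ℂ) * (s - 1).choose (2 * k) = s.choose (2 * k + 1) * (2 * k + 1) := by
          cases s with
          | zero => simp
          | succ s =>
            rw [Nat.add_sub_cancel]
            exact_mod_cast Nat.add_one_mul_choose_eq s (2 * k)
        have e5 : ((2 * (k + 1)).factorial : ℂ)
            = 2 * (k + 1) * ((2 * k + 1) * (2 * k).factorial) := by
          rw [show 2 * (k + 1) = (2 * k + 1) + 1 by ring, Nat.factorial_succ, Nat.factorial_succ]
          push_cast
          ring
        have e6 : ((k + 1).factorial : ℂ) = (k + 1) * k.factorial := by
          rw [Nat.factorial_succ]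
          push_cast
          ring
        have e7 : ((2 * (k + 1)).factorial : ℂ) / (k + 1).factorial
            = 2 * (2 * k + 1) * ((2 * k).factorial / k.factorial) := by
          rw [e5, e6]
          field_simp
        rw [e1, e3, mul_div_assoc, mul_div_assoc, mul_div_assoc, e7]
        linear_combination (2 * (2 * k + 1) * ((2 * k).factorial / k.factorial : ℂ)) * e2
          + (2 * c ^ (s - 1 - 2 * k) * ((2 * k).factorial / k.factorial : ℂ)) * e4
      · simp [smul_smul, pow_succ']

/-- The graded traces of the states `a[-1]^s 𝟏` are Gaussian moments. -/
theorem sectorTrace_squareState (hA : ∑ i, A i * pairing B b A i = 1) (α : Λ) (M s : ℕ) :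
    sectorTrace B b α M (squareState B b A s) = ∑ k ∈ range (s / 2 + 1),
      ((s.choose (2 * k) : ℂ) * (2 * k).factorial / k.factorial
          * (∑ i, A i * B (b i) α) ^ (s - 2 * k)) •
        (truncEisenstein M 2 ^ k * sectorTrace B b α M 1) := by
  refine gaussian_recursion _ _ (fun s => sectorTrace B b α M (squareState B b A s)) (fun s => ?_) s
    (s / 2 + 1) (by omega)
  have := sectorTrace_squareOp B b A hA α M (R := 0) Even.zero s
  simpa [← squareState_succ] using this

end SectorTrace

/-! ### From the trace on `V_Λ` to traces on sectors -/

section LatticeTrace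

open MvPolynomial Finset

variable {d : ℕ} {Λ : Type*} [AddCommGroup Λ]

/-- The Cauchy–Schwarz inequality bounds the numbers `⟨α, b i⟩`, which determine `α`. -/
theorem finite_setOf_apply_self_le (B : LinearMap.BilinForm ℤ Λ) (b : Module.Basis (Fin d) ℤ Λ)
    (hsymm : ∀ α β, B α β = B β α) (hpos : ∀ α, α ≠ 0 → 0 < B α α) (C : ℤ) :
    {α : Λ | B α α ≤ C}.Finite := by
  have hnonneg : ∀ α, 0 ≤ B α α := fun α => by
    by_cases h : α = 0
    · simp [h]
    · exact (hpos α h).le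
  let f : Λ → Fin d → ℤ := fun α i => B α (b i)
  have hinj : Function.Injective f := by
    intro α β h
    by_contra hne
    have h1 : B (α - β) = 0 := b.ext fun i => by
      have := congrFun h i
      simp only [f] at this
      simp [this]
    have h2 := hpos _ (sub_ne_zero.2 hne)
    rw [h1] at h2
    simp at h2
  refine Set.Finite.subset ((Set.Finite.pi' fun i : Fin d =>
    Set.finite_Icc (-(C * B (b i) (b i))) (C * B (b i) (b i))).preimage hinj.injOn) ?_
  intro α hα i
  have hcs : B α (b i) * B (b i) α ≤ B α α * B (b i) (b i) :=
    LinearMap.BilinForm.apply_mul_apply_le_of_forall_zero_le B hnonneg _ _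
  rw [hsymm (b i) α] at hcs
  have h1 : B α α * B (b i) (b i) ≤ C * B (b i) (b i) :=
    mul_le_mul_of_nonneg_right hα (hnonneg _)
  have h2 : |B α (b i)| ≤ B α (b i) * B α (b i) := by
    rw [← abs_mul_abs_self]
    rcases (abs_nonneg (B α (b i))).eq_or_lt with h | h
    · simp [← h]
    · exact le_mul_of_one_le_left h.le h
  exact abs_le.1 (h2.trans (hcs.trans h1))

/-- The trace of an endomorphism in terms of a finite resolution of the identity. -/
theorem trace_eq_sum_of_resolution {W ι : Type*} [AddCommGroup W] [Module ℂ W] [Fintype ι]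
    (T : Module.End ℂ W) (e : ι → W) (φ : ι → Module.Dual ℂ W)
    (h : ∀ w, w = ∑ i, φ i w • e i) : LinearMap.trace ℂ W T = ∑ i, φ i (T (e i)) := by
  have : Module.Finite ℂ W := by
    refine Module.Finite.of_surjective (Fintype.linearCombination ℂ e) fun w => ⟨fun i => φ i w, ?_⟩
    rw [Fintype.linearCombination_apply, ← h w]
  have hT : T = ∑ i, dualTensorHom ℂ W W (φ i ⊗ₜ[ℂ] T (e i)) := by
    ext w
    rw [LinearMap.sum_apply]
    conv_lhs => rw [h w, map_sum]
    simp
  conv_lhs => rw [hT, map_sum]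
  simp [LinearMap.trace_eq_contract_apply]

theorem weight_oscWeight (s : Fin d × ℕ →₀ ℕ) : Finsupp.weight oscWeight s = (wt s : ℤ) := by
  rw [wt, Finsupp.weight_apply, Finsupp.weight_apply, Finsupp.sum, Finsupp.sum]
  push_cast
  exact sum_congr rfl fun y _ => by simp [oscWeight, oscLevel]

theorem sum_map_oscLevel_toMultiset (s : Fin d × ℕ →₀ ℕ) :
    ((Finsupp.toMultiset s).map oscLevel).sum = wt s := by
  induction s using Finsupp.induction_linear with
  | zero => simp
  | add s t hs ht => rw [map_add, Multiset.map_add, Multiset.sum_add, hs, ht, wt, wt, wt, map_add]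
  | single y n => simp [wt, Finsupp.weight_apply, Multiset.map_nsmul, Multiset.sum_nsmul]

theorem mem_weightExponents_modeVars {M N : ℕ} (hN : N ≤ M) {s : Fin d × ℕ →₀ ℕ} :
    s ∈ weightExponents (modeVars d M) oscLevel N ↔ wt s = N := by
  rw [mem_weightExponents oscLevel_pos, and_iff_right_iff_imp]
  intro hs y hy
  have := wt_sub_single hy
  replace hs : wt s = N := hs
  rw [mem_modeVars]
  omega

theorem weightProj_single_zero (B : LinearMap.BilinForm ℤ Λ) (k : ℤ) (f : Heis d) :
    weightProj d B k (Finsupp.single 0 f)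
      = Finsupp.single 0 (weightedHomogeneousComponent oscWeight k f) := by
  simp [weightProj]

theorem zeroMode_single_add (B : LinearMap.BilinForm ℤ Λ) (b : Module.Basis (Fin d) ℤ Λ)
    (f g : Heis d) :
    zeroMode B b (Finsupp.single 0 (f + g))
      = zeroMode B b (Finsupp.single 0 f) + zeroMode B b (Finsupp.single 0 g) := by
  have hfin : ∀ f : Heis d, (Function.support fun k : ℤ =>
      mode B b (weightProj d B k (Finsupp.single 0 f)) (k - 1)).Finite := by
    intro f
    refine (weightedHomogeneousComponent_finsupp (w := oscWeight) f).subset fun k hk h0 => hk ?_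
    simp only at h0 ⊢
    rw [weightProj_single_zero, h0]
    simp [mode]
  rw [zeroMode, zeroMode, zeroMode, ← finsum_add_distrib (hfin f) (hfin g)]
  refine finsum_congr fun k => ?_
  rw [Finsupp.single_add, map_add, mode, map_add, map_add]
  rfl

theorem zeroMode_single_monomial (B : LinearMap.BilinForm ℤ Λ) (b : Module.Basis (Fin d) ℤ Λ)
    (s : Fin d × ℕ →₀ ℕ) (c : ℂ) :
    zeroMode B b (Finsupp.single 0 (monomial s c))
      = mode B b (Finsupp.single 0 (monomial s c)) (wt s - 1) := by
  have hh : IsWeightedHomogeneous oscWeight (monomial s c : Heis d) (wt s : ℤ) :=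
    isWeightedHomogeneous_monomial _ _ _ (weight_oscWeight s)
  rw [zeroMode, finsum_eq_single _ (wt s : ℤ)]
  · rw [weightProj_single_zero, hh.weightedHomogeneousComponent_same]
  · intro k hk
    rw [weightProj_single_zero, hh.weightedHomogeneousComponent_ne _ hk]
    simp [mode]

/-- The diagonal matrix entries of zero modes agree with those of the fields at `z = 1`. -/
theorem coeff_zeroMode_single (B : LinearMap.BilinForm ℤ Λ) (b : Module.Basis (Fin d) ℤ Λ)
    (α : Λ) {M : ℕ} (f : Heis d) {s : Fin d × ℕ →₀ ℕ} (hs : wt s ≤ M) :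
    coeff s (zeroMode B b (Finsupp.single 0 f) (Finsupp.single α (monomial s 1)) α)
      = coeff s (wickField (modeVars d M) creationCoeff (annihilationCoeff B b)
          (zeroModeCoeff B b α) f (monomial s 1)) := by
  induction f using MvPolynomial.induction_on' with
  | add p q hp hq =>
    rw [zeroMode_single_add, map_add, LinearMap.add_apply, LinearMap.add_apply, Finsupp.add_apply,
      coeff_add, coeff_add, hp, hq]
  | monomial u c =>
    have hc : monomial u c = c • monomial u (1 : ℂ) := by simp [smul_monomial]
    rw [zeroMode_single_monomial, mode, VertexOperator.ncoeff_apply]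
    have h1 : (HVertexOperator.coeff (Y B b (Finsupp.single 0 (monomial u c))) (-(wt u - 1 : ℤ) - 1)
          (Finsupp.single α (monomial s 1))) α
        = c • (monomialField B b 0 α u (monomial s 1)).coeff (-(wt u - 1 : ℤ) - 1) := by
      have h2 : ∀ (z : LaurentSeries (Heis d)) (k : ℤ),
          ((HahnModule.of ℂ).symm (inclSector d α z)).coeff k α = z.coeff k := by
        intro z k
        simp [inclSector]
      rw [HVertexOperator.coeff_apply_apply, Y_single_monomial, h2, HahnSeries.coeff_smul]
    rw [h1, hc, map_smul, LinearMap.smul_apply, coeff_smul, coeff_smul, wickField_monomial,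
      monomialField, LinearMap.comp_apply, constZ_monomial, one_smul,
      coeff_foldr_normalOrder B b α _ s s 0 _ hs, if_pos]
    rw [sum_map_oscLevel_toMultiset]
    push_cast
    ring

/-- The trace of a zero mode on a weight space of `V_Λ` is a sum over the sectors. -/
theorem zeroModeTrace_single (B : LinearMap.BilinForm ℤ Λ) (b : Module.Basis (Fin d) ℤ Λ)
    (heven : ∀ α, Even (B α α)) (hpos : ∀ α, α ≠ 0 → 0 < B α α) (f : Heis d) {n M : ℕ}
    (hn : n ≤ M) (S : Finset Λ) (hS : ∀ α, α ∈ S ↔ B α α ≤ 2 * n) :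
    zeroModeTrace B b (Finsupp.single 0 f) n
      = ∑ α ∈ S, PowerSeries.coeff (n - (B α α / 2).toNat) (sectorTrace B b α M f) := by
  classical
  have hnonneg : ∀ α, 0 ≤ B α α := fun α => by
    by_cases h : α = 0
    · simp [h]
    · exact (hpos α h).le
  -- `J` indexes the monomial basis of the weight space
  set J := S.sigma fun α => weightExponents (modeVars d M) oscLevel (n - (B α α / 2).toNat) with hJ
  have hmem : ∀ α s, (⟨α, s⟩ : Σ _ : Λ, (Fin d × ℕ →₀ ℕ)) ∈ J ↔ (wt s : ℤ) = n - B α α / 2 := by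
    intro α s
    rw [hJ, mem_sigma, hS, mem_weightExponents_modeVars (by omega)]
    obtain ⟨m, hm⟩ := heven α
    have := hnonneg α
    simp only
    omega
  let e : J → weightSpace d B (n : ℤ) := fun i =>
    ⟨Finsupp.single i.1.1 (monomial i.1.2 1), fun α => by
      by_cases h : i.1.1 = α
      · subst h
        rw [Finsupp.single_eq_same]
        exact isWeightedHomogeneous_monomial _ _ _
          ((weight_oscWeight _).trans ((hmem _ _).1 i.2))
      · rw [Finsupp.single_apply, if_neg h]
        exact Submodule.zero_mem _⟩
  let φ₀ : (Σ _ : Λ, (Fin d × ℕ →₀ ℕ)) → V d Λ →ₗ[ℂ] ℂ := fun i =>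
    lcoeff ℂ i.2 ∘ₗ Finsupp.lapply i.1
  let φ : J → Module.Dual ℂ (weightSpace d B (n : ℤ)) := fun i =>
    φ₀ i.1 ∘ₗ (weightSpace d B (n : ℤ)).subtype
  rw [zeroModeTrace, trace_eq_sum_of_resolution _ e φ]
  · have h1 : ∀ i : J, φ i (((weightProj d B (n : ℤ)).codRestrict (weightSpace d B n)
        (weightProj_mem B n) ∘ₗ zeroMode B b (Finsupp.single 0 f)
          ∘ₗ (weightSpace d B (n : ℤ)).subtype) (e i))
        = coeff i.1.2 (zeroMode B b (Finsupp.single 0 f)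
            (Finsupp.single i.1.1 (monomial i.1.2 1)) i.1.1) := by
      intro i
      change coeff i.1.2 (weightProj d B n (zeroMode B b (Finsupp.single 0 f)
            (Finsupp.single i.1.1 (monomial i.1.2 1))) i.1.1) = _
      rw [weightProj_apply, coeff_weightedHomogeneousComponent, if_pos]
      exact (weight_oscWeight _).trans ((hmem _ _).1 i.2)
    simp only [h1]
    rw [sum_coe_sort J fun i => coeff i.2 (zeroMode B b (Finsupp.single 0 f)
            (Finsupp.single i.1 (monomial i.2 1)) i.1), hJ, sum_sigma]
    refine sum_congr rfl fun α hα => ?_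
    rw [sectorTrace, LinearMap.comp_apply, coeff_gradedTrace]
    refine sum_congr rfl fun s hs => ?_
    rw [mem_weightExponents_modeVars (by omega)] at hs
    exact coeff_zeroMode_single B b α f (hs.le.trans ((Nat.sub_le _ _).trans hn))
  · intro w
    apply Subtype.ext
    rw [AddSubmonoidClass.coe_finsetSum]
    have : ∑ i : J, ((φ i w • e i : weightSpace d B (n : ℤ)) : V d Λ)
        = ∑ i ∈ J, (φ₀ i w.1) • (Finsupp.single i.1 (monomial i.2 1) : V d Λ) :=
      sum_coe_sort J fun i => (φ₀ i w.1) • (Finsupp.single i.1 (monomial i.2 1) : V d Λ)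
    rw [this]
    ext β t
    rw [Finsupp.finsetSum_apply, coeff_sum, sum_eq_single (⟨β, t⟩ : Σ _ : Λ, (Fin d × ℕ →₀ ℕ))]
    · simp [φ₀]
    · rintro ⟨α, s⟩ - hne
      rw [Finsupp.smul_apply, Finsupp.single_apply]
      split_ifs with h
      · subst h
        rw [coeff_smul, coeff_monomial, if_neg (fun h => hne (Sigma.ext rfl (heq_of_eq h))),
          smul_zero]
      · rw [smul_zero, coeff_zero]
    · intro hβ
      have h0 : coeff t (w.1 β) = 0 := by
        by_contra hne
        exact hβ ((hmem β t).2 ((weight_oscWeight t).symm.trans (w.2 β hne)))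
      simp [φ₀, h0]

end LatticeTrace

/-! ### The character -/

section Character

open Finset

variable {d : ℕ} {Λ : Type*} [AddCommGroup Λ]

/-- Reduction of power series modulo `q^(n+1)`. -/
abbrev modXPow (n : ℕ) : PowerSeries ℂ →+*
    PowerSeries ℂ ⧸ Ideal.span {(PowerSeries.X : PowerSeries ℂ) ^ (n + 1)} :=
  Ideal.Quotient.mk _

theorem modXPow_eq_iff {n : ℕ} {f g : PowerSeries ℂ} :
    modXPow n f = modXPow n g ↔ ∀ j ≤ n, PowerSeries.coeff j f = PowerSeries.coeff j g := by
  rw [Ideal.Quotient.eq, Ideal.mem_span_singleton, PowerSeries.X_pow_dvd_iff]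
  refine forall_congr' fun j => ?_
  rw [Nat.lt_succ_iff, map_sub, sub_eq_zero]

theorem coeff_truncEisenstein {M k j : ℕ} (hj : j ≤ M) :
    PowerSeries.coeff j (truncEisenstein M k) = PowerSeries.coeff j (eisensteinG k) := by
  have h : PowerSeries.coeff j (∑ l ∈ range M, ((l + 1 : ℂ) ^ (k - 1)) • lambertTerm (l + 1))
      = ∑ l ∈ range M, if j ≠ 0 ∧ (l + 1) ∣ j then ((l + 1 : ℕ) : ℂ) ^ (k - 1) else 0 := by
    rw [map_sum]
    refine sum_congr rfl fun l _ => ?_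
    rw [PowerSeries.coeff_smul, lambertTerm, PowerSeries.coeff_mk, smul_eq_mul, mul_ite, mul_one,
      mul_zero]
    push_cast
    rfl
  rw [truncEisenstein, map_add, h, eisensteinG, PowerSeries.coeff_mk, PowerSeries.coeff_C]
  split_ifs with h0
  · simp [h0]
  · rw [zero_add, ArithmeticFunction.sigma_apply, Nat.cast_sum, ← sum_filter]
    refine sum_bij (fun l _ => l + 1) ?_ ?_ ?_ ?_
    · intro l hl
      rw [mem_filter] at hl
      exact Nat.mem_divisors.2 ⟨hl.2.2, h0⟩
    · intro l _ l' _ h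
      exact Nat.succ_injective h
    · intro e he
      have h1 := Nat.pos_of_mem_divisors he
      have h2 := Nat.dvd_of_mem_divisors he
      have h3 := Nat.le_of_dvd (Nat.pos_of_ne_zero h0) h2
      refine ⟨e - 1, ?_, by omega⟩
      rw [mem_filter, mem_range, Nat.sub_add_cancel h1]
      exact ⟨by omega, h0, h2⟩
    · intro l _
      rw [Nat.cast_pow]

/-- Euler's product `∏ (1 - q^n)`. -/
def eulerProduct : PowerSeries ℂ :=
  PowerSeries.mk fun N =>
    PowerSeries.coeff N (∏ n ∈ Finset.Icc 1 N, (1 - PowerSeries.X ^ n : PowerSeries ℂ))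

theorem eta_eq : eta = HahnSeries.single (1 / 24 : ℚ) (1 : ℂ) *
    HahnSeries.ofPowerSeries ℚ ℂ eulerProduct := rfl

theorem constantCoeff_eulerProduct : PowerSeries.constantCoeff eulerProduct = 1 := by
  simp [eulerProduct]

theorem coeff_prod_range {j M : ℕ} (hj : j ≤ M) :
    PowerSeries.coeff j (∏ l ∈ range M, (1 - PowerSeries.X ^ (l + 1) : PowerSeries ℂ))
      = PowerSeries.coeff j eulerProduct := by
  induction M, hj using Nat.le_induction with
  | base =>
    rw [eulerProduct, PowerSeries.coeff_mk, range_eq_Ico, prod_Ico_add' (fun l =>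
      (1 - PowerSeries.X ^ l : PowerSeries ℂ)) 0 j 1]
    rfl
  | succ M hM ih =>
    rw [prod_range_succ, mul_sub, mul_one, map_sub, ih, PowerSeries.coeff_mul_X_pow',
      if_neg (by omega), sub_zero]

/-- The graded dimension of the truncated Fock space. -/
theorem sectorTrace_one_mul (B : LinearMap.BilinForm ℤ Λ) (b : Module.Basis (Fin d) ℤ Λ) (α : Λ)
    (M : ℕ) : sectorTrace B b α M 1
        * (∏ l ∈ range M, (1 - PowerSeries.X ^ (l + 1) : PowerSeries ℂ)) ^ d = 1 := by
  rw [sectorTrace, LinearMap.comp_apply, wickField_one]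
  refine Eq.trans ?_ (gradedTrace_id_mul_prod oscLevel_pos (modeVars d M))
  rw [modeVars, prod_product]
  simp [oscLevel]

theorem modXPow_sectorTrace_one (B : LinearMap.BilinForm ℤ Λ) (b : Module.Basis (Fin d) ℤ Λ)
    (α : Λ) (M : ℕ) :
    modXPow M (sectorTrace B b α M 1) = modXPow M (eulerProduct ^ d)⁻¹ := by
  have h1 := congrArg (modXPow M) (sectorTrace_one_mul B b α M)
  have h2 : eulerProduct ^ d * (eulerProduct ^ d)⁻¹ = 1 :=
    PowerSeries.mul_inv_cancel _ (by simp [constantCoeff_eulerProduct])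
  have h3 := congrArg (modXPow M) h2
  have h4 : modXPow M (∏ l ∈ range M, (1 - PowerSeries.X ^ (l + 1) : PowerSeries ℂ))
      = modXPow M eulerProduct := modXPow_eq_iff.2 fun j hj => coeff_prod_range hj
  rw [map_mul, map_pow, h4, ← map_pow, map_one (modXPow M)] at h1
  rw [map_mul, map_one (modXPow M)] at h3
  exact left_inv_eq_right_inv h1 h3

theorem baseChange_apply_one_tmul (B : LinearMap.BilinForm ℤ Λ) (b : Module.Basis (Fin d) ℤ Λ)
    (a : TensorProduct ℤ ℂ Λ) (α : Λ) :
    LinearMap.BilinForm.baseChange ℂ B a (TensorProduct.tmul ℤ (1 : ℂ) α)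
      = ∑ i, (b.baseChange ℂ).repr a i * B (b i) α := by
  conv_lhs => rw [← (b.baseChange ℂ).sum_repr a]
  rw [map_sum, LinearMap.sum_apply]
  refine sum_congr rfl fun i _ => ?_
  rw [map_smul, LinearMap.smul_apply, Module.Basis.baseChange_apply,
    LinearMap.BilinForm.baseChange_tmul]
  simp

theorem sum_repr_mul_pairing (B : LinearMap.BilinForm ℤ Λ) (b : Module.Basis (Fin d) ℤ Λ)
    (a : TensorProduct ℤ ℂ Λ) :
    ∑ j, (b.baseChange ℂ).repr a j * pairing B b ((b.baseChange ℂ).repr a) j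
      = LinearMap.BilinForm.baseChange ℂ B a a := by
  conv_rhs => rw [← (b.baseChange ℂ).sum_repr a]
  rw [map_sum]
  refine sum_congr rfl fun j _ => ?_
  rw [map_smul, Module.Basis.baseChange_apply, (b.baseChange ℂ).sum_repr a,
    baseChange_apply_one_tmul]
  rfl

/-- A coefficient of `Θ_{Λ,s} D` as a sum over lattice vectors rather than over norms. -/
theorem coeff_theta_mul (B : LinearMap.BilinForm ℤ Λ) (heven : ∀ α, Even (B α α))
    (hpos : ∀ α, α ≠ 0 → 0 < B α α) (a : TensorProduct ℤ ℂ Λ) (s n : ℕ) (D : PowerSeries ℂ)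
    (S : Finset Λ) (hS : ∀ α, α ∈ S ↔ B α α ≤ 2 * n) :
    PowerSeries.coeff n (theta B a s * D)
      = ∑ α ∈ S, (LinearMap.BilinForm.baseChange ℂ B a (TensorProduct.tmul ℤ (1 : ℂ) α)) ^ s
          * PowerSeries.coeff (n - (B α α / 2).toNat) D := by
  have hnonneg : ∀ α, 0 ≤ B α α := fun α => by
    by_cases h : α = 0
    · simp [h]
    · exact (hpos α h).le
  have hq : ∀ α (i : ℕ), (B α α / 2).toNat = i ↔ B α α = 2 * (i : ℤ) := by
    intro α i
    obtain ⟨m, hm⟩ := heven α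
    have := hnonneg α
    omega
  have hmaps : ∀ α ∈ S, (B α α / 2).toNat ∈ range (n + 1) := by
    intro α hα
    have h1 := (hS α).1 hα
    have := hnonneg α
    rw [mem_range]
    omega
  rw [PowerSeries.coeff_mul, Nat.sum_antidiagonal_eq_sum_range_succ_mk,
    ← sum_fiberwise_of_maps_to hmaps]
  refine sum_congr rfl fun i hi => ?_
  have hset : {α : Λ | B α α = 2 * (i : ℤ)}
      = ((S.filter fun α => (B α α / 2).toNat = i : Finset Λ) : Set Λ) := by
    ext α
    rw [Set.mem_ofPred_eq, mem_coe, mem_filter, hq, hS]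
    have := mem_range.1 hi
    omega
  rw [theta, PowerSeries.coeff_mk, hset, finsum_mem_coe_finset, sum_mul]
  refine sum_congr rfl fun α hα => ?_
  rw [(mem_filter.1 hα).2]

theorem iterate_squareMode_vacuum (B : LinearMap.BilinForm ℤ Λ) (b : Module.Basis (Fin d) ℤ Λ)
    (a : TensorProduct ℤ ℂ Λ) (s : ℕ) :
    (squareMode B b a (-1))^[s] (vacuum d Λ)
      = Finsupp.single 0 (squareState B b ((b.baseChange ℂ).repr a) s) := by
  induction s with
  | zero => rfl
  | succ s ih =>
    have := squareMode_neg_single B b a 1 (squareState B b ((b.baseChange ℂ).repr a) s)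
    rw [Function.iterate_succ_apply', ih, squareState_succ, squareOp]
    simpa using this

/-- The identity of the character with the powers of `q^(1/24)` removed. -/
theorem mk_zeroModeTrace_mul (b : Module.Basis (Fin d) ℤ Λ)
    (B : LinearMap.BilinForm ℤ Λ) (hsymm : ∀ α β, B α β = B β α)
    (heven : ∀ α, Even (B α α)) (hpos : ∀ α, α ≠ 0 → 0 < B α α)
    (a : TensorProduct ℤ ℂ Λ) (ha : LinearMap.BilinForm.baseChange ℂ B a a = 1)
    {r t : ℕ} (hr : Odd r) (hr3 : 3 ≤ r) :
    (PowerSeries.mk fun n : ℕ => zeroModeTrace B b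
        (((r - 1).factorial : ℂ) • squareMode B b a (-(r : ℤ))
          ((squareMode B b a (-1))^[t] (vacuum d Λ))) n) * eulerProduct ^ d
      = 2 * (t : PowerSeries ℂ) * eisensteinG (r + 1) *
            ∑ k ∈ Finset.range ((t - 1) / 2 + 1),
              (((t - 1).choose (2 * k) : ℂ) * (2 * k).factorial / k.factorial) •
                (eisensteinG 2 ^ k * theta B a (t - 2 * k - 1)) := by
  set A : Fin d → ℂ := ⇑((b.baseChange ℂ).repr a) with hAdef
  have hA : ∑ i, A i * pairing B b A i = 1 := (sum_repr_mul_pairing B b a).trans ha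
  obtain ⟨R, rfl⟩ : ∃ R, r = R + 1 := ⟨r - 1, by omega⟩
  have hR : Even R := by
    rcases Nat.even_or_odd R with h | h
    · exact h
    · exact absurd hr (Nat.not_odd_iff_even.2 h.add_one)
  rw [Nat.add_sub_cancel, iterate_squareMode_vacuum, squareMode_neg_single, Finsupp.smul_single]
  change (PowerSeries.mk fun n : ℕ => zeroModeTrace B b (Finsupp.single 0
    ((R.factorial : ℂ) • squareOp B b A (R + 1) (squareState B b A t))) n) * _ = _
  set f := (R.factorial : ℂ) • squareOp B b A (R + 1) (squareState B b A t) with hf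
  have hRf : (R.factorial : ℂ) ≠ 0 := by exact_mod_cast R.factorial_ne_zero
  -- the trace on a sector depends on `α` only through `⟨a, α⟩`
  let coef : ℕ → ℂ := fun k => ((t - 1).choose (2 * k) : ℂ) * (2 * k).factorial / k.factorial
  have hsector : ∀ α M, sectorTrace B b α M f = ∑ k ∈ range ((t - 1) / 2 + 1),
      (LinearMap.BilinForm.baseChange ℂ B a (TensorProduct.tmul ℤ (1 : ℂ) α)) ^ (t - 2 * k - 1) •
        (2 * t * coef k) • (truncEisenstein M (R + 2) * truncEisenstein M 2 ^ k
          * sectorTrace B b α M 1) := by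
    intro α M
    rw [hf, map_smul, sectorTrace_squareOp B b A hA α M hR, zero_pow (by omega), zero_div, mul_zero,
      zero_smul, zero_add, smul_smul, mul_div_cancel₀ _ hRf, sectorTrace_squareState B b A hA,
      mul_sum, smul_sum, baseChange_apply_one_tmul B b]
    refine sum_congr rfl fun k _ => ?_
    rw [mul_smul_comm, smul_smul, smul_smul, mul_assoc (truncEisenstein M (R + 2)),
      show t - 1 - 2 * k = t - 2 * k - 1 by omega]
    congr 1
    simp only [coef]
    ring
  let D : ℕ → PowerSeries ℂ := fun k =>
    (2 * t * coef k) • (eisensteinG (R + 2) * eisensteinG 2 ^ k * (eulerProduct ^ d)⁻¹)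
  -- truncation at level `M` does not affect the coefficients of `q^j` with `j ≤ M`
  have hD : ∀ α M k j, j ≤ M → PowerSeries.coeff j ((2 * t * coef k) •
      (truncEisenstein M (R + 2) * truncEisenstein M 2 ^ k * sectorTrace B b α M 1))
        = PowerSeries.coeff j (D k) := by
    intro α M k j hj
    have h : modXPow M (truncEisenstein M (R + 2) * truncEisenstein M 2 ^ k
        * sectorTrace B b α M 1)
        = modXPow M (eisensteinG (R + 2) * eisensteinG 2 ^ k * (eulerProduct ^ d)⁻¹) := by
      have hE : ∀ k, modXPow M (truncEisenstein M k) = modXPow M (eisensteinG k) :=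
        fun k => modXPow_eq_iff.2 fun j hj => coeff_truncEisenstein hj
      simp only [map_mul, map_pow, hE, modXPow_sectorTrace_one]
    rw [PowerSeries.coeff_smul, modXPow_eq_iff.1 h j hj, ← PowerSeries.coeff_smul]
  have hmain : (PowerSeries.mk fun n : ℕ => zeroModeTrace B b (Finsupp.single 0 f) n)
      = ∑ k ∈ range ((t - 1) / 2 + 1), theta B a (t - 2 * k - 1) * D k := by
    ext n
    have hfin := finite_setOf_apply_self_le B b hsymm hpos (2 * n)
    have hS : ∀ α, α ∈ hfin.toFinset ↔ B α α ≤ 2 * n := fun α => by simp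
    rw [PowerSeries.coeff_mk, zeroModeTrace_single B b heven hpos f le_rfl _ hS, map_sum]
    simp only [coeff_theta_mul B heven hpos a _ n _ _ hS]
    rw [sum_comm]
    refine sum_congr rfl fun α _ => ?_
    rw [hsector, map_sum]
    refine sum_congr rfl fun k _ => ?_
    rw [PowerSeries.coeff_smul, hD α n k _ (Nat.sub_le _ _), smul_eq_mul]
  have hinv : (eulerProduct ^ d)⁻¹ * eulerProduct ^ d = 1 :=
    PowerSeries.inv_mul_cancel _ (by simp [constantCoeff_eulerProduct])
  rw [hmain, sum_mul, mul_sum]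
  refine sum_congr rfl fun k _ => ?_
  simp only [D, coef, PowerSeries.smul_eq_C_mul, map_mul, map_natCast, map_ofNat]
  rw [show R + 1 + 1 = R + 2 by ring]
  linear_combination (theta B a (t - 2 * k - 1) * (2 * (t : PowerSeries ℂ) * PowerSeries.C
    (((t - 1).choose (2 * k) : ℂ) * (2 * k).factorial / k.factorial)
      * (eisensteinG (R + 2) * eisensteinG 2 ^ k))) * hinv

end Character

end LatticeVOA

theorem mainTheorem4 {d : ℕ} {Λ : Type*} [AddCommGroup Λ] (b : Module.Basis (Fin d) ℤ Λ)
    (B : LinearMap.BilinForm ℤ Λ) (hsymm : ∀ α β, B α β = B β α)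
    (heven : ∀ α, Even (B α α)) (hpos : ∀ α, α ≠ 0 → 0 < B α α)
    (a : TensorProduct ℤ ℂ Λ) (ha : LinearMap.BilinForm.baseChange ℂ B a a = 1)
    (r t : ℕ) (hr : Odd r) (hr3 : 3 ≤ r) (ht : Odd t) (ht1 : 1 ≤ t) :
    LatticeVOA.character B b
        (((r - 1).factorial : ℂ) • LatticeVOA.squareMode B b a (-(r : ℤ))
          ((LatticeVOA.squareMode B b a (-1))^[t] (LatticeVOA.vacuum d Λ)))
      = HahnSeries.ofPowerSeries ℚ ℂ
          (2 * (t : PowerSeries ℂ) * LatticeVOA.eisensteinG (r + 1) *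
            ∑ k ∈ Finset.range ((t - 1) / 2 + 1),
              (((t - 1).choose (2 * k) : ℂ) * (2 * k).factorial / k.factorial) •
                (LatticeVOA.eisensteinG 2 ^ k * LatticeVOA.theta B a (t - 2 * k - 1)))
        / LatticeVOA.eta ^ d := by
  have hne : LatticeVOA.eulerProduct ≠ 0 := fun h => by
    simpa [h] using LatticeVOA.constantCoeff_eulerProduct
  have heta : LatticeVOA.eta ^ d ≠ 0 := by
    refine pow_ne_zero _ (mul_ne_zero (HahnSeries.single_ne_zero one_ne_zero) ?_)
    exact (map_ne_zero_iff _ HahnSeries.ofPowerSeries_injective).2 hne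
  rw [eq_div_iff heta, LatticeVOA.character,
    ← LatticeVOA.mk_zeroModeTrace_mul b B hsymm heven hpos a ha hr hr3, LatticeVOA.eta_eq, mul_pow,
    HahnSeries.single_pow, one_pow, ← map_pow, mul_mul_mul_comm, HahnSeries.single_mul_single,
    ← map_mul, one_mul, nsmul_eq_mul, show (-(d : ℚ) / 24 + d * (1 / 24)) = 0 by ring,
    HahnSeries.single_zero_one, one_mul]

end
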